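/- **Definitions.** For a finite graph $H$ and an integer $k\ge 0$, and independent sets $A,B$ of $H$ with $|A|,|B|\ge k$, write $A\leftrightarrow_k^H B$ if there is a sequence of independent sets of $H$, all of size at least $k$, from $A$ to $B$, in which each set arises from the previous one by adding or removing one vertex. A *generalized cotree* $T$ of a graph $G$ is a finite rooted binary tree in which every nonleaf node has a left and a right child and is marked as a *union node* or a *join node*, and in which every leaf $u$ carries a nonempty graph $G_u$, the graphs of distinct leaves being disjoint. For a nonleaf node $u$ with children $v,w$, the graph $G_u$ is the disjoint union of $G_v$ and $G_w$ if $u$ is a union node, and their complete join if $u$ is a join node; it is required that $G_r=G$ for the root $r$. Put $V_u=V(G_u)$. A leaf $u$ is *trivial* if $|V_u|=1$. Let $I$ be an independent set of $G$. For a node $u$ and $\ell\in\{0,\dots,|I\cap V_u|\}$, let $\mathrm{RIS}^I_\ell(u)$ be the maximum of $|J|$ over all independent sets $J$ of $G_u$ with $(I\cap V_u)\leftrightarrow_\ell^{G_u}J$. For a union node $u$ with left child $v$ and right child $w$ and $\ell\in\{0,\dots,|I\cap V_u|\}$, a pair of integers $(x,y)$ with $x\le|I\cap V_v|$, $y\le|I\cap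 V_w|$ is *$\ell$-stable* if $$x=\max\{0,\ell-\mathrm{RIS}^I_y(w)\}\quad\text{and}\quad y=\max\{0,\ell-\mathrm{RIS}^I_x(v)\},$$ and a *maximum $\ell$-stable tuple* if moreover no other $\ell$-stable $(x',y')$ has $x'\ge x$ and $y'\ge y$. **Theorem.** There is an algorithm (a single program for a unit-cost random access machine whose arithmetic operations are addition and truncated subtraction) that does the following for every generalized cotree $T$ of a finite graph $G$ on $n$ vertices and every independent set $I$ of $G$. Its input consists of the tree $T$ (arbitrarily numbered nodes, with root, node types, pointers to left and right children, and the vertex at each trivial leaf), the membership table of $I$ and, for every nontrivial leaf $v$, the number $|I\cap V_v|$ and the values $\mathrm{RIS}^I_\ell(v)$ for $\ell\in\{0,\dots,|I\cap V_v|\}$. It computes * the values $\mathrm{RIS}^I_\ell(u)$ for all nodes $u$ of $T$ and all $\ell\in\{0,\dots,|I\cap V_u|\}$, and * the (unique) maximum $\ell$-stable tuple for every union node $u$ of $T$ and every $\ell\in\{0,\dots,|I\cap V_u|\}$, with time complexity $O(M)$, where $$M=\sum_{u\in V(T)}\max\{1,|I\cap V_u|\}\le n^2 ,$$ so in particular $O(n^2)$.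 The constant in $O(M)$ is absolute. (If $I$ meets every $V_u$, then $M=\sum_{u\in V(T)}|I\cap V_u|$.) -/

import Mathlib

/-! ### Generalized cotrees -/

/-- The two kinds of nonleaf nodes. -/
inductive NodeOp where
  | union
  | join

/-- Rooted ordered binary trees whose leaves carry a graph and whose nonleaf nodes are marked as
union or join nodes. A leaf `leaf S H` carries the graph with vertex set `S` and edge set that of
`H`. A node of a tree is identified with its position, see `GCotree.Node`. -/
inductive GCotree (V : Type*) where
  | leaf (S : Finset V) (H : SimpleGraph V)
  | node (op : NodeOp) (l r : GCotree V)

namespace GCotree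

/-- The vertex set `V_u` of the graph `G_u`, where `u` is the root of the tree. -/
def verts {V : Type*} [DecidableEq V] : GCotree V → Finset V
  | leaf S _ => S
  | node _ l r => l.verts ∪ r.verts

/-- The edges of the graph `G_u`, where `u` is the root of the tree: disjoint union at union nodes,
complete join at join nodes. -/
def graph {V : Type*} [DecidableEq V] : GCotree V → SimpleGraph V
  | leaf _ H => H
  | node .union l r => l.graph ⊔ r.graph
  | node .join l r =>
      l.graph ⊔ r.graph ⊔ (⊤ : SimpleGraph V).between (l.verts : Set V) (r.verts : Set V)

/-- Every leaf carries a graph with at least one vertex, whose edges join vertices of that leaf, and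
the graphs of distinct leaves are vertex (hence edge) disjoint. -/
def WellFormed {V : Type*} [DecidableEq V] : GCotree V → Prop
  | leaf S H => S.Nonempty ∧ ∀ a b, H.Adj a b → a ∈ S ∧ b ∈ S
  | node _ l r => l.WellFormed ∧ r.WellFormed ∧ Disjoint l.verts r.verts

/-- `T` is a generalized cotree for the graph `G`: the graph at the root of `T` is `G`. -/
def IsCotreeOf {V : Type*} [DecidableEq V] [Fintype V] (T : GCotree V) (G : SimpleGraph V) : Prop :=
  T.WellFormed ∧ T.verts = Finset.univ ∧ T.graph = G

/-- The type of nodes of a tree: `none` is the root of `node op l r`, `some (inl u)` is the node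
`u` of the left subtree `l`, and `some (inr u)` is the node `u` of the right subtree `r`. -/
def Node {V : Type*} : GCotree V → Type
  | leaf _ _ => Unit
  | node _ l r => Option (l.Node ⊕ r.Node)

instance instFintypeNode {V : Type*} : (T : GCotree V) → Fintype T.Node
  | leaf _ _ => inferInstanceAs (Fintype Unit)
  | node _ l r =>
      letI := instFintypeNode l
      letI := instFintypeNode r
      inferInstanceAs (Fintype (Option (l.Node ⊕ r.Node)))

/-- The root node. -/
def root {V : Type*} : (T : GCotree V) → T.Node
  | leaf _ _ => ()
  | node _ _ _ => none

/-- The subtree rooted at a node. -/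
def sub {V : Type*} : (T : GCotree V) → T.Node → GCotree V
  | leaf S H, _ => leaf S H
  | node op l r, none => node op l r
  | node _ l _, some (.inl u) => l.sub u
  | node _ _ r, some (.inr u) => r.sub u

end GCotree

/-! ### Token addition and removal -/

/-- `J` is a vertex of `TAR_k` of the graph with vertex set `S` and the edges of `H`: an independent
set of size at least `k`. -/
def IsTARVertex {V : Type*} (S : Finset V) (H : SimpleGraph V) (k : ℕ) (J : Finset V) : Prop :=
  J ⊆ S ∧ H.IsIndepSet (J : Set V) ∧ k ≤ J.card

/-- `A` and `B` are vertices of `TAR_k` and one is obtained from the other by adding a token. -/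
def TARAdj {V : Type*} [DecidableEq V] (S : Finset V) (H : SimpleGraph V) (k : ℕ)
    (A B : Finset V) : Prop :=
  IsTARVertex S H k A ∧ IsTARVertex S H k B ∧ A ≠ B ∧ ∃ v, insert v A = B ∨ A = insert v B

/-- `TAR_k` contains a path from `A` to `B`. -/
def TARReach {V : Type*} [DecidableEq V] (S : Finset V) (H : SimpleGraph V) (k : ℕ)
    (A B : Finset V) : Prop :=
  IsTARVertex S H k A ∧ IsTARVertex S H k B ∧ Relation.ReflTransGen (TARAdj S H k) A B

namespace GCotree

/-- The number `|I ∩ V_u|` of tokens on `G_u`, for `u` the root of `t`. -/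
def tokens {V : Type*} [DecidableEq V] (t : GCotree V) (I : Finset V) : ℕ := (I ∩ t.verts).card

/-- `RIS^I_ℓ(u)`, for `u` the root of `t`: the maximum of `|J|` over all independent sets `J` of
`G_u` that are reachable from `I ∩ V_u` in `TAR_ℓ(G_u)`. (Used for `ℓ ≤ |I ∩ V_u|` only.) -/
noncomputable def RIS {V : Type*} [DecidableEq V] (t : GCotree V) (I : Finset V) (ℓ : ℕ) : ℕ :=
  sSup {m | ∃ J : Finset V, TARReach t.verts t.graph ℓ (I ∩ t.verts) J ∧ J.card = m}

/-- `(x, y)` is `ℓ`-stable for a union node with left child `v` (the root of `l`) and right child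
`w` (the root of `r`). Subtraction is truncated, so that `ℓ - a` stands for `max {0, ℓ - a}`. -/
def IsStable {V : Type*} [DecidableEq V] (l r : GCotree V) (I : Finset V) (ℓ x y : ℕ) : Prop :=
  x ≤ l.tokens I ∧ y ≤ r.tokens I ∧ x = ℓ - r.RIS I y ∧ y = ℓ - l.RIS I x

/-- `(x, y)` is a maximum `ℓ`-stable tuple. -/
def IsMaxStable {V : Type*} [DecidableEq V] (l r : GCotree V) (I : Finset V) (ℓ x y : ℕ) : Prop :=
  l.IsStable r I ℓ x y ∧
    ¬ ∃ x' y', l.IsStable r I ℓ x' y' ∧ x ≤ x' ∧ y ≤ y' ∧ (x, y) ≠ (x', y')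

end GCotree

/-! ### The machine model

Structured programs for a random access machine with natural number registers and finitely many
(statically named) unbounded arrays of natural numbers. The arithmetic operations are addition and
truncated subtraction. Every elementary instruction and every test costs one step. -/

/-- Machine states: `reg i` is register `i`, and `arr a i` is entry `i` of array `a`. -/
structure RAMState where
  reg : ℕ → ℕ
  arr : ℕ → ℕ → ℕ

/-- The state with register `d` set to `x`. -/
def RAMState.setReg (σ : RAMState) (d x : ℕ) : RAMState :=
  ⟨Function.update σ.reg d x, σ.arr⟩

/-- The state with entry `i` of array `a` set to `x`. -/
def RAMState.setArr (σ : RAMState) (a i x : ℕ) : RAMState :=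
  ⟨σ.reg, Function.update σ.arr a (Function.update (σ.arr a) i x)⟩

/-- Programs. -/
inductive RAMProg where
  /-- do nothing -/
  | skip
  /-- set register `d` to the number `k` -/
  | const (d k : ℕ)
  /-- set register `d` to the sum of registers `i` and `j` -/
  | add (d i j : ℕ)
  /-- set register `d` to register `i` minus register `j`, or to zero if this is negative -/
  | sub (d i j : ℕ)
  /-- set register `d` to the entry of array `a` whose index is in register `i` -/
  | load (d a i : ℕ)
  /-- set the entry of array `a` whose index is in register `i` to register `j` -/
  | store (a i j : ℕ)
  /-- run `p`, then `q` -/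
  | seq (p q : RAMProg)
  /-- if register `i` is nonzero run `p`, else run `q` -/
  | cond (i : ℕ) (p q : RAMProg)
  /-- as long as register `i` is nonzero, run `p` -/
  | loop (i : ℕ) (p : RAMProg)

/-- `Exec p σ c σ'`: started in state `σ`, the program `p` halts after exactly `c` steps, in state
`σ'`. -/
inductive RAMProg.Exec : RAMProg → RAMState → ℕ → RAMState → Prop where
  | skip (σ) : Exec .skip σ 1 σ
  | const (d k σ) : Exec (.const d k) σ 1 (σ.setReg d k)
  | add (d i j σ) : Exec (.add d i j) σ 1 (σ.setReg d (σ.reg i + σ.reg j))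
  | sub (d i j σ) : Exec (.sub d i j) σ 1 (σ.setReg d (σ.reg i - σ.reg j))
  | load (d a i σ) : Exec (.load d a i) σ 1 (σ.setReg d (σ.arr a (σ.reg i)))
  | store (a i j σ) : Exec (.store a i j) σ 1 (σ.setArr a (σ.reg i) (σ.reg j))
  | seq {p q σ₁ σ₂ σ₃ c d} : Exec p σ₁ c σ₂ → Exec q σ₂ d σ₃ → Exec (.seq p q) σ₁ (c + d) σ₃
  | condTrue {i p q σ σ' c} : σ.reg i ≠ 0 → Exec p σ c σ' → Exec (.cond i p q) σ (c + 1) σ'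
  | condFalse {i p q σ σ' c} : σ.reg i = 0 → Exec q σ c σ' → Exec (.cond i p q) σ (c + 1) σ'
  | loopDone {i p σ} : σ.reg i = 0 → Exec (.loop i p) σ 1 σ
  | loopStep {i p σ₁ σ₂ σ₃ c d} : σ₁.reg i ≠ 0 → Exec p σ₁ c σ₂ → Exec (.loop i p) σ₂ d σ₃ →
      Exec (.loop i p) σ₁ (c + d + 1) σ₃

/-- Execution is deterministic. -/
theorem RAMProg.Exec.deterministic {p : RAMProg} {σ σ₁ : RAMState} {c : ℕ}
    (h : p.Exec σ c σ₁) : ∀ {d : ℕ} {σ₂ : RAMState}, p.Exec σ d σ₂ → c = d ∧ σ₁ = σ₂ := by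
  induction h with
  | skip | const | add | sub | load | store => intro d σ₂ h'; cases h'; exact ⟨rfl, rfl⟩
  | seq _ _ ih₁ ih₂ =>
      intro d σ₂ h'
      cases h' with
      | seq a b =>
        obtain ⟨rfl, rfl⟩ := ih₁ a
        obtain ⟨rfl, rfl⟩ := ih₂ b
        exact ⟨rfl, rfl⟩
  | condTrue h₀ _ ih =>
      intro d σ₂ h'
      cases h' with
      | condTrue _ a => obtain ⟨rfl, rfl⟩ := ih a; exact ⟨rfl, rfl⟩
      | condFalse h₁ _ => exact absurd h₁ h₀
  | condFalse h₀ _ ih =>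
      intro d σ₂ h'
      cases h' with
      | condTrue h₁ _ => exact absurd h₀ h₁
      | condFalse _ a => obtain ⟨rfl, rfl⟩ := ih a; exact ⟨rfl, rfl⟩
  | loopDone h₀ =>
      intro d σ₂ h'
      cases h' with
      | loopDone => exact ⟨rfl, rfl⟩
      | loopStep h₁ _ _ => exact absurd h₀ h₁
  | loopStep h₀ _ _ ih₁ ih₂ =>
      intro d σ₂ h'
      cases h' with
      | loopDone h₁ => exact absurd h₁ h₀
      | loopStep _ a b =>
        obtain ⟨rfl, rfl⟩ := ih₁ a
        obtain ⟨rfl, rfl⟩ := ih₂ b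
        exact ⟨rfl, rfl⟩

/-! ### Input and output -/

namespace RAMArray

/-- Input, indexed by nodes: 0 trivial leaf, 1 nontrivial leaf, 2 union node, 3 join node. -/
abbrev kind : ℕ := 0
/-- Input, indexed by nonleaf nodes: the left child. -/
abbrev left : ℕ := 1
/-- Input, indexed by nonleaf nodes: the right child. -/
abbrev right : ℕ := 2
/-- Input, indexed by trivial leaves: the unique vertex of the graph at this leaf. -/
abbrev vertex : ℕ := 3
/-- Input, indexed by vertices of the graph: 1 for members of the independent set, 0 otherwise. -/
abbrev member : ℕ := 4
/-- Input, indexed by nontrivial leaves: the number of tokens on the leaf. -/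
abbrev leafTokens : ℕ := 5
/-- Input, indexed by nontrivial leaves: where the table of RIS values of the leaf starts. -/
abbrev leafStart : ℕ := 6
/-- Input: the tables of RIS values of the nontrivial leaves. -/
abbrev leafRIS : ℕ := 7
/-- Output, indexed by nodes: where the tables of the node start. -/
abbrev outStart : ℕ := 8
/-- Output: the tables of RIS values of the nodes. -/
abbrev outRIS : ℕ := 9
/-- Output: the tables of first entries of the maximum stable tuples of the union nodes. -/
abbrev outX : ℕ := 10
/-- Output: the tables of second entries of the maximum stable tuples of the union nodes. -/
abbrev outY : ℕ := 11

end RAMArray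

/-- The code of a kind of nonleaf node in the array `kind`. -/
def NodeOp.code : NodeOp → ℕ
  | union => 2
  | join => 3

/-- The arrays of `σ` hold the part of the input that describes the nodes of the tree, when nodes
are numbered by `num` and vertices by `vnum`. -/
def GCotree.StoredIn {V : Type*} [DecidableEq V] (σ : RAMState) (I : Finset V) (vnum : V → ℕ) :
    (t : GCotree V) → (num : t.Node → ℕ) → Prop
  | leaf S H, num =>
      (∀ v, S = {v} →
        σ.arr RAMArray.kind (num ()) = 0 ∧ σ.arr RAMArray.vertex (num ()) = vnum v) ∧
      (S.card ≠ 1 →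
        σ.arr RAMArray.kind (num ()) = 1 ∧
        σ.arr RAMArray.leafTokens (num ()) = (leaf S H).tokens I ∧
        ∀ ℓ ≤ (leaf S H).tokens I,
          σ.arr RAMArray.leafRIS (σ.arr RAMArray.leafStart (num ()) + ℓ) = (leaf S H).RIS I ℓ)
  | node op l r, num =>
      σ.arr RAMArray.kind (num none) = op.code ∧
      σ.arr RAMArray.left (num none) = num (some (.inl l.root)) ∧
      σ.arr RAMArray.right (num none) = num (some (.inr r.root)) ∧
      l.StoredIn σ I vnum (fun u => num (some (.inl u))) ∧
      r.StoredIn σ I vnum (fun u => num (some (.inr u)))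

/-- `σ` is an initial state for the tree `T` and the independent set `I`: register `0` holds the
root, and the input arrays hold the nodes of `T` and the characteristic function of `I`. The contents
of all other registers, arrays and array entries are arbitrary. -/
def IsInput {V : Type*} [DecidableEq V] [Fintype V] (T : GCotree V) (I : Finset V)
    (num : T.Node ≃ Fin (Fintype.card T.Node)) (vnum : V ≃ Fin (Fintype.card V))
    (σ : RAMState) : Prop :=
  σ.reg 0 = num T.root ∧
  (∀ v, σ.arr RAMArray.member (vnum v) = if v ∈ I then 1 else 0) ∧
  T.StoredIn σ I (fun v => vnum v) (fun u => num u)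

/-- `σ` holds all values `RIS^I_ℓ(u)`, for all nodes `u` and `0 ≤ ℓ ≤ |I ∩ V_u|`, and the
maximum `ℓ`-stable tuples (of which there is exactly one), for all union nodes `u` and
`0 ≤ ℓ ≤ |I ∩ V_u|`. -/
def IsOutput {V : Type*} [DecidableEq V] (T : GCotree V) (I : Finset V)
    (num : T.Node ≃ Fin (Fintype.card T.Node)) (σ : RAMState) : Prop :=
  (∀ u : T.Node, ∀ ℓ ≤ (T.sub u).tokens I,
    σ.arr RAMArray.outRIS (σ.arr RAMArray.outStart (num u) + ℓ) = (T.sub u).RIS I ℓ) ∧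
  (∀ (u : T.Node) (l r : GCotree V), T.sub u = .node .union l r →
    ∀ ℓ ≤ (T.sub u).tokens I, ∀ x y : ℕ, l.IsMaxStable r I ℓ x y ↔
      x = σ.arr RAMArray.outX (σ.arr RAMArray.outStart (num u) + ℓ) ∧
      y = σ.arr RAMArray.outY (σ.arr RAMArray.outStart (num u) + ℓ))

/-! ### Token addition and removal: general facts -/

section TokenAdditionRemoval

variable {V : Type*} [DecidableEq V] {S S₁ S₂ : Finset V} {H H₁ H₂ : SimpleGraph V}
  {k ℓ : ℕ} {A B C J : Finset V}

/-! The values at an inner node follow from recurrences in the values at its children, so one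
bottom-up pass suffices. Write `R₁`, `R₂` for the RIS functions of the two children; both are
antitone in the level, since a walk at a high level is also a walk at every lower one.

Union nodes. Let `(x, y)` be `ℓ`-stable. A walk at level `ℓ` keeps at least `x` tokens on the left
and `y` on the right: while this holds, the right carries at most `R₂ y` tokens, so the left must
carry at least `ℓ - R₂ y`, and symmetrically. Hence the walk projects to legal walks on both sides
(`TARReach.inter`), and no reachable set exceeds `R₁ x + R₂ y`. Conversely, collect maximum sets on
both sides at the token counts as levels, then repeatedly lower one level to what the tokens on the
other side permit and maximise again. This stops at a stable pair whose two maxima are held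
simultaneously (`exists_stable_le_tarMax_union`). That pair lies below the greatest stable pair, so
by antitonicity the bounds meet there (`tarMax_union`).

Join nodes. An independent set lies on one side. At a positive level it is never empty, hence cannot
change sides, and the values are those of the side with the tokens. At level `0` every independent
set is reachable through the empty set, and the value is the maximum over the two sides.

Time. At a union node with `t` tokens the greatest stable pairs for all levels come from a single
descent. The level falls from `t` to `0` and `(x, y)` is kept above every stable pair of the current
and lower levels; a coordinate exceeding its prescribed value is lowered to it, and otherwise the
pair is the answer and the level drops. Every round lowers the level, `x` or `y`, so there are `O(t
+ 1)` rounds (`unionLoop_terminates`). Leaves and join nodes only copy tables. A depth-first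
traversal with an explicit stack adds constant cost per node (`reaches_subtree`), and the total is
`O(M)`. -/

/-- All edges of `H` join vertices of `S`. -/
def EdgesIn {V : Type*} (H : SimpleGraph V) (S : Finset V) : Prop :=
  ∀ a b, H.Adj a b → a ∈ S ∧ b ∈ S

/-- The maximum size of a set reachable from `A` in `TAR_ℓ`. -/
noncomputable def tarMax {V : Type*} [DecidableEq V] (S : Finset V) (H : SimpleGraph V)
    (A : Finset V) (ℓ : ℕ) : ℕ :=
  sSup {m | ∃ J : Finset V, TARReach S H ℓ A J ∧ J.card = m}

omit [DecidableEq V] in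
theorem IsTARVertex.mono_level (h : IsTARVertex S H k A) (hk : ℓ ≤ k) : IsTARVertex S H ℓ A :=
  ⟨h.1, h.2.1, hk.trans h.2.2⟩

theorem IsTARVertex.refl (h : IsTARVertex S H k A) : TARReach S H k A A := ⟨h, h, .refl⟩

theorem TARAdj.symm (h : TARAdj S H k A B) : TARAdj S H k B A := by
  obtain ⟨hA, hB, hne, v, hv⟩ := h
  exact ⟨hB, hA, hne.symm, v, hv.symm.imp Eq.symm Eq.symm⟩

theorem TARReach.symm (h : TARReach S H k A B) : TARReach S H k B A :=
  ⟨h.2.1, h.1, Relation.ReflTransGen.mono (fun _ _ => TARAdj.symm) _ _ h.2.2.swap⟩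

theorem TARReach.trans (h : TARReach S H k A B) (h' : TARReach S H k B C) : TARReach S H k A C :=
  ⟨h.1, h'.2.1, h.2.2.trans h'.2.2⟩

theorem TARReach.mono_level (h : TARReach S H k A B) (hk : ℓ ≤ k) : TARReach S H ℓ A B :=
  ⟨h.1.mono_level hk, h.2.1.mono_level hk, Relation.ReflTransGen.mono (fun _ _ hab =>
    ⟨hab.1.mono_level hk, hab.2.1.mono_level hk, hab.2.2⟩) _ _ h.2.2⟩

/-- Adding or removing one token, or doing nothing. -/
theorem TARReach.single (hA : IsTARVertex S H k A) (hB : IsTARVertex S H k B)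
    (h : ∃ v, insert v A = B ∨ A = insert v B) : TARReach S H k A B := by
  by_cases hne : A = B
  · exact hne ▸ hA.refl
  · exact ⟨hA, hB, .single ⟨hA, hB, hne, h⟩⟩

theorem TARReach.card_le_tarMax (h : TARReach S H ℓ A J) : J.card ≤ tarMax S H A ℓ := by
  refine le_csSup ⟨S.card, ?_⟩ ⟨J, h, rfl⟩
  rintro _ ⟨K, hK, rfl⟩
  exact Finset.card_le_card hK.2.1.1

theorem IsTARVertex.exists_reach_card_eq_tarMax (h : IsTARVertex S H ℓ A) :
    ∃ J, TARReach S H ℓ A J ∧ J.card = tarMax S H A ℓ := by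
  have hne : {m | ∃ J : Finset V, TARReach S H ℓ A J ∧ J.card = m}.Nonempty := ⟨_, A, h.refl, rfl⟩
  refine Nat.sSup_mem hne ⟨S.card, ?_⟩
  rintro _ ⟨K, hK, rfl⟩
  exact Finset.card_le_card hK.2.1.1

theorem IsTARVertex.card_le_tarMax (h : IsTARVertex S H ℓ A) : A.card ≤ tarMax S H A ℓ :=
  h.refl.card_le_tarMax

theorem tarMax_anti (h : IsTARVertex S H k A) (hk : ℓ ≤ k) : tarMax S H A k ≤ tarMax S H A ℓ := by
  obtain ⟨J, hJ, hc⟩ := h.exists_reach_card_eq_tarMax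
  exact hc ▸ (hJ.mono_level hk).card_le_tarMax

/-- Without a lower bound on the number of tokens, every independent set is reachable. -/
theorem tarReach_zero (hA : IsTARVertex S H 0 A) (hJ : IsTARVertex S H 0 J) :
    TARReach S H 0 A J := by
  have key : ∀ B : Finset V, IsTARVertex S H 0 B → TARReach S H 0 ∅ B := by
    intro B
    induction B using Finset.induction_on with
    | empty => exact fun h => h.refl
    | insert v B _ ih =>
      intro h
      have hB : IsTARVertex S H 0 B :=
        ⟨(Finset.subset_insert v B).trans h.1,
          h.2.1.mono (Finset.coe_subset.2 (Finset.subset_insert v B)), Nat.zero_le _⟩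
      exact (ih hB).trans (TARReach.single hB h ⟨v, .inl rfl⟩)
  exact (key A hA).symm.trans (key J hJ)

/-! ### Disjoint unions -/

theorem indepSet_sup_iff (h₁ : EdgesIn H₁ S₁) (h₂ : EdgesIn H₂ S₂) :
    (H₁ ⊔ H₂).IsIndepSet (J : Set V) ↔
      H₁.IsIndepSet ((J ∩ S₁ : Finset V) : Set V) ∧ H₂.IsIndepSet ((J ∩ S₂ : Finset V) : Set V) := by
  simp only [SimpleGraph.IsIndepSet, Set.Pairwise, SimpleGraph.sup_adj, Finset.coe_inter,
    Set.mem_inter_iff, Finset.mem_coe, not_or]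
  constructor
  · exact fun h => ⟨fun a ha b hb hab => (h ha.1 hb.1 hab).1, fun a ha b hb hab => (h ha.1 hb.1 hab).2⟩
  · rintro ⟨h, h'⟩ a ha b hb hab
    exact ⟨fun e => h ⟨ha, (h₁ _ _ e).1⟩ ⟨hb, (h₁ _ _ e).2⟩ hab e,
      fun e => h' ⟨ha, (h₂ _ _ e).1⟩ ⟨hb, (h₂ _ _ e).2⟩ hab e⟩

theorem union_inter_left_of_disjoint (hd : Disjoint S₁ S₂) (hA : A ⊆ S₁) (hB : B ⊆ S₂) :
    (A ∪ B) ∩ S₁ = A := by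
  rw [Finset.union_inter_distrib_right, Finset.inter_eq_left.2 hA,
    Finset.disjoint_iff_inter_eq_empty.1 (hd.symm.mono_left hB), Finset.union_empty]

theorem union_inter_right_of_disjoint (hd : Disjoint S₁ S₂) (hA : A ⊆ S₁) (hB : B ⊆ S₂) :
    (A ∪ B) ∩ S₂ = B := by
  rw [Finset.union_comm]
  exact union_inter_left_of_disjoint hd.symm hB hA

theorem card_inter_add_card_inter (hd : Disjoint S₁ S₂) (hJ : J ⊆ S₁ ∪ S₂) :
    (J ∩ S₁).card + (J ∩ S₂).card = J.card := by
  rw [← Finset.card_union_of_disjoint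
    (hd.mono Finset.inter_subset_right Finset.inter_subset_right),
    ← Finset.inter_union_distrib_left, Finset.inter_eq_left.2 hJ]

theorem isTARVertex_union (h₁ : EdgesIn H₁ S₁) (h₂ : EdgesIn H₂ S₂) (hd : Disjoint S₁ S₂)
    {p q : ℕ} (hA : IsTARVertex S₁ H₁ p A) (hB : IsTARVertex S₂ H₂ q B)
    (hℓ : ℓ ≤ A.card + B.card) : IsTARVertex (S₁ ∪ S₂) (H₁ ⊔ H₂) ℓ (A ∪ B) := by
  refine ⟨Finset.union_subset_union hA.1 hB.1, ?_, ?_⟩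
  · rw [indepSet_sup_iff h₁ h₂, union_inter_left_of_disjoint hd hA.1 hB.1,
      union_inter_right_of_disjoint hd hA.1 hB.1]
    exact ⟨hA.2.1, hB.2.1⟩
  · rwa [Finset.card_union_of_disjoint (hd.mono hA.1 hB.1)]

/-- The tokens of `C` stand still while the walk runs on `S₁`, so at least `p + C.card` tokens are
always present. -/
theorem TARReach.union_left (h₁ : EdgesIn H₁ S₁) (h₂ : EdgesIn H₂ S₂) (hd : Disjoint S₁ S₂)
    {p q : ℕ} (h : TARReach S₁ H₁ p A B) (hC : IsTARVertex S₂ H₂ q C) (hℓ : ℓ ≤ p + C.card) :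
    TARReach (S₁ ∪ S₂) (H₁ ⊔ H₂) ℓ (A ∪ C) (B ∪ C) := by
  have hv : ∀ {D}, IsTARVertex S₁ H₁ p D → IsTARVertex (S₁ ∪ S₂) (H₁ ⊔ H₂) ℓ (D ∪ C) :=
    fun hD => isTARVertex_union h₁ h₂ hd hD hC (hℓ.trans (Nat.add_le_add_right hD.2.2 _))
  refine ⟨hv h.1, hv h.2.1, h.2.2.lift' (fun D => D ∪ C) ?_⟩
  rintro D E ⟨hD, hE, -, v, hDE⟩
  refine (TARReach.single (hv hD) (hv hE) ⟨v, ?_⟩).2.2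
  rcases hDE with rfl | rfl
  · exact .inl (Finset.insert_union v D C).symm
  · exact .inr (Finset.insert_union v E C)

theorem TARReach.union_right (h₁ : EdgesIn H₁ S₁) (h₂ : EdgesIn H₂ S₂) (hd : Disjoint S₁ S₂)
    {p q : ℕ} (h : TARReach S₂ H₂ p A B) (hC : IsTARVertex S₁ H₁ q C) (hℓ : ℓ ≤ p + C.card) :
    TARReach (S₁ ∪ S₂) (H₁ ⊔ H₂) ℓ (C ∪ A) (C ∪ B) := by
  rw [Finset.union_comm S₁, sup_comm H₁, Finset.union_comm C, Finset.union_comm C]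
  exact h.union_left h₂ h₁ hd.symm hC hℓ

/-- A move inside `S₁` respects the lower bound `x` on the number of tokens on `S₁`, if at most
`ℓ - x` tokens can be collected on `S₂`. -/
theorem TARReach.move_inter (h₁ : EdgesIn H₁ S₁) (h₂ : EdgesIn H₂ S₂) (hd : Disjoint S₁ S₂)
    {x y : ℕ} {A₁ A₂ K : Finset V} (hx : x ≤ ℓ - tarMax S₂ H₂ A₂ y)
    (hJ₁ : TARReach S₁ H₁ x A₁ (J ∩ S₁)) (hJ₂ : TARReach S₂ H₂ y A₂ (J ∩ S₂))
    (hK : IsTARVertex (S₁ ∪ S₂) (H₁ ⊔ H₂) ℓ K) (hKJ : K ∩ S₂ = J ∩ S₂)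
    (h : ∃ v, insert v (J ∩ S₁) = K ∩ S₁ ∨ J ∩ S₁ = insert v (K ∩ S₁)) :
    TARReach S₁ H₁ x A₁ (K ∩ S₁) := by
  refine hJ₁.trans (TARReach.single hJ₁.2.1
    ⟨Finset.inter_subset_right, ((indepSet_sup_iff h₁ h₂).1 hK.2.1).1, ?_⟩ h)
  have h1 := card_inter_add_card_inter hd hK.1
  have h2 := hJ₂.card_le_tarMax
  have h3 := hK.2.2
  rw [hKJ] at h1
  omega

/-- Neither projection can be treated alone: the lower bound on one side comes from the cap on the
other, which itself needs reachability there. The induction along the walk therefore carries both.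
Only the inequalities `≤` of stability are used. -/
theorem TARReach.inter (h₁ : EdgesIn H₁ S₁) (h₂ : EdgesIn H₂ S₂) (hd : Disjoint S₁ S₂)
    {x y : ℕ} {A₁ A₂ : Finset V} (hA₁ : IsTARVertex S₁ H₁ x A₁) (hA₂ : IsTARVertex S₂ H₂ y A₂)
    (hx : x ≤ ℓ - tarMax S₂ H₂ A₂ y) (hy : y ≤ ℓ - tarMax S₁ H₁ A₁ x)
    (h : TARReach (S₁ ∪ S₂) (H₁ ⊔ H₂) ℓ (A₁ ∪ A₂) J) :
    TARReach S₁ H₁ x A₁ (J ∩ S₁) ∧ TARReach S₂ H₂ y A₂ (J ∩ S₂) := by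
  obtain ⟨-, -, h⟩ := h
  induction h with
  | refl =>
    rw [union_inter_left_of_disjoint hd hA₁.1 hA₂.1, union_inter_right_of_disjoint hd hA₁.1 hA₂.1]
    exact ⟨hA₁.refl, hA₂.refl⟩
  | @tail J K _ hJK ih =>
    obtain ⟨ih₁, ih₂⟩ := ih
    obtain ⟨hJ, hK, -, v, hv⟩ := hJK
    have hvS : v ∈ S₁ ∪ S₂ := by
      rcases hv with rfl | rfl
      · exact hK.1 (Finset.mem_insert_self _ _)
      · exact hJ.1 (Finset.mem_insert_self _ _)
    have hin : ∀ {S : Finset V}, v ∈ S →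
        insert v (J ∩ S) = K ∩ S ∨ J ∩ S = insert v (K ∩ S) := by
      intro S hS
      rcases hv with rfl | rfl
      · exact .inl (Finset.insert_inter_of_mem hS).symm
      · exact .inr (Finset.insert_inter_of_mem hS)
    have hout : ∀ {S : Finset V}, v ∉ S → K ∩ S = J ∩ S := by
      intro S hS
      rcases hv with rfl | rfl
      · exact Finset.insert_inter_of_notMem hS
      · exact (Finset.insert_inter_of_notMem hS).symm
    rcases Finset.mem_union.1 hvS with hv₁ | hv₂
    · have hKJ := hout (Finset.disjoint_left.1 hd hv₁)
      exact ⟨TARReach.move_inter h₁ h₂ hd hx ih₁ ih₂ hK hKJ ⟨v, hin hv₁⟩, hKJ ▸ ih₂⟩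
    · have hKJ := hout (Finset.disjoint_right.1 hd hv₂)
      rw [Finset.union_comm, sup_comm] at hK
      exact ⟨hKJ ▸ ih₁, TARReach.move_inter h₂ h₁ hd.symm hy ih₂ ih₁ hK hKJ ⟨v, hin hv₂⟩⟩

/-- Some fixed point `(p, q)` has the property that maximum sets on both sides, for the levels `p`
and `q`, are reachable simultaneously. -/
theorem exists_stable_le_tarMax_union (h₁ : EdgesIn H₁ S₁) (h₂ : EdgesIn H₂ S₂)
    (hd : Disjoint S₁ S₂) {A₁ A₂ : Finset V} (hA₁ : IsTARVertex S₁ H₁ A₁.card A₁)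
    (hA₂ : IsTARVertex S₂ H₂ A₂.card A₂) (hℓ : ℓ ≤ A₁.card + A₂.card) :
    ∃ p q, p ≤ A₁.card ∧ q ≤ A₂.card ∧ p = ℓ - tarMax S₂ H₂ A₂ q ∧ q = ℓ - tarMax S₁ H₁ A₁ p ∧
      tarMax S₁ H₁ A₁ p + tarMax S₂ H₂ A₂ q ≤ tarMax (S₁ ∪ S₂) (H₁ ⊔ H₂) (A₁ ∪ A₂) ℓ := by
  -- The pairs satisfying stability as inequalities whose two maximum sets can be held at once. A
  -- pair of least sum will be stable.
  let P : ℕ → Prop := fun n => ∃ p q B₁ B₂, p + q = n ∧ p ≤ A₁.card ∧ q ≤ A₂.card ∧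
    ℓ - tarMax S₂ H₂ A₂ q ≤ p ∧ ℓ - tarMax S₁ H₁ A₁ p ≤ q ∧
    TARReach S₁ H₁ p A₁ B₁ ∧ B₁.card = tarMax S₁ H₁ A₁ p ∧
    TARReach S₂ H₂ q A₂ B₂ ∧ B₂.card = tarMax S₂ H₂ A₂ q ∧
    TARReach (S₁ ∪ S₂) (H₁ ⊔ H₂) ℓ (A₁ ∪ A₂) (B₁ ∪ B₂)
  have hP : ∃ n, P n := by
    -- The token counts themselves are such a pair: maximise on `S₁` with `A₂` fixed, then on `S₂`
    -- with `B₁` fixed.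
    obtain ⟨B₁, hB₁, hc₁⟩ := hA₁.exists_reach_card_eq_tarMax
    obtain ⟨B₂, hB₂, hc₂⟩ := hA₂.exists_reach_card_eq_tarMax
    have hm₁ := hA₁.card_le_tarMax
    have hm₂ := hA₂.card_le_tarMax
    exact ⟨_, _, _, B₁, B₂, rfl, le_rfl, le_rfl, by omega, by omega, hB₁, hc₁, hB₂, hc₂,
      (hB₁.union_left h₁ h₂ hd hA₂ hℓ).trans
        (hB₂.union_right h₁ h₂ hd hB₁.2.1 (by omega))⟩
  classical
  obtain ⟨p, q, B₁, B₂, hpq, hp, hq, hp', hq', hB₁, hc₁, hB₂, hc₂, hB⟩ := Nat.find_spec hP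
  have hmin : ∀ m < p + q, ¬ P m := fun m hm => Nat.find_min hP (hpq ▸ hm)
  refine ⟨p, q, hp, hq, ?_, ?_, ?_⟩
  · by_contra hne
    have hlt : ℓ - tarMax S₂ H₂ A₂ q < p := by omega
    -- The tokens of `B₂` allow the left to drop to the smaller level, so `B₁` can be walked back to
    -- `A₁` and on to a maximum set `C` for that level. The other inequality survives because
    -- `tarMax` is antitone, which contradicts minimality.
    obtain ⟨C, hC, hcC⟩ :=
      (hA₁.mono_level (hlt.le.trans hp)).exists_reach_card_eq_tarMax
    have hanti := tarMax_anti (hA₁.mono_level hp) hlt.le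
    exact hmin _ (Nat.add_lt_add_right hlt q) ⟨_, q, C, B₂, rfl, hlt.le.trans hp, hq, le_rfl,
      by omega, hC, hcC, hB₂, hc₂, hB.trans
        (((hB₁.mono_level hlt.le).symm.trans hC).union_left h₁ h₂ hd hB₂.2.1 (by omega))⟩
  · by_contra hne
    have hlt : ℓ - tarMax S₁ H₁ A₁ p < q := by omega
    obtain ⟨C, hC, hcC⟩ :=
      (hA₂.mono_level (hlt.le.trans hq)).exists_reach_card_eq_tarMax
    have hanti := tarMax_anti (hA₂.mono_level hq) hlt.le
    exact hmin _ (Nat.add_lt_add_left hlt p) ⟨p, _, B₁, C, rfl, hp, hlt.le.trans hq, by omega,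
      le_rfl, hB₁, hc₁, hC, hcC, hB.trans
        (((hB₂.mono_level hlt.le).symm.trans hC).union_right h₁ h₂ hd hB₁.2.1 (by omega))⟩
  · have := hB.card_le_tarMax
    rwa [Finset.card_union_of_disjoint (hd.mono hB₁.2.1.1 hB₂.2.1.1), hc₁, hc₂] at this

/-- The upper bound holds at every stable pair; only the lower bound needs `(x, y)` to be the
greatest, to compare it with the pair from `exists_stable_le_tarMax_union`. -/
theorem tarMax_union (h₁ : EdgesIn H₁ S₁) (h₂ : EdgesIn H₂ S₂)
    (hd : Disjoint S₁ S₂) {A₁ A₂ : Finset V} (hA₁ : IsTARVertex S₁ H₁ A₁.card A₁)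
    (hA₂ : IsTARVertex S₂ H₂ A₂.card A₂) (hℓ : ℓ ≤ A₁.card + A₂.card) {x y : ℕ}
    (hx : x ≤ A₁.card) (hy : y ≤ A₂.card) (hx' : x = ℓ - tarMax S₂ H₂ A₂ y)
    (hy' : y = ℓ - tarMax S₁ H₁ A₁ x)
    (hmax : ∀ p q, p ≤ A₁.card → q ≤ A₂.card → p = ℓ - tarMax S₂ H₂ A₂ q →
      q = ℓ - tarMax S₁ H₁ A₁ p → p ≤ x ∧ q ≤ y) :
    tarMax (S₁ ∪ S₂) (H₁ ⊔ H₂) (A₁ ∪ A₂) ℓ = tarMax S₁ H₁ A₁ x + tarMax S₂ H₂ A₂ y := by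
  apply le_antisymm
  · obtain ⟨J, hJ, hc⟩ := (isTARVertex_union h₁ h₂ hd hA₁ hA₂ hℓ).exists_reach_card_eq_tarMax
    obtain ⟨hJ₁, hJ₂⟩ := TARReach.inter h₁ h₂ hd (hA₁.mono_level hx) (hA₂.mono_level hy)
      hx'.le hy'.le hJ
    rw [← hc, ← card_inter_add_card_inter hd hJ.2.1.1]
    exact Nat.add_le_add hJ₁.card_le_tarMax hJ₂.card_le_tarMax
  · obtain ⟨p, q, hp, hq, hp', hq', hle⟩ := exists_stable_le_tarMax_union h₁ h₂ hd hA₁ hA₂ hℓ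
    obtain ⟨hpx, hqy⟩ := hmax p q hp hq hp' hq'
    exact (Nat.add_le_add (tarMax_anti (hA₁.mono_level hx) hpx)
      (tarMax_anti (hA₂.mono_level hy) hqy)).trans hle

/-! ### Joins -/

/-- The complete join. -/
abbrev joinGraph {V : Type*} (S₁ S₂ : Finset V) (H₁ H₂ : SimpleGraph V) : SimpleGraph V :=
  H₁ ⊔ H₂ ⊔ (⊤ : SimpleGraph V).between (S₁ : Set V) (S₂ : Set V)

omit [DecidableEq V] in
theorem joinGraph_comm (S₁ S₂ : Finset V) (H₁ H₂ : SimpleGraph V) :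
    joinGraph S₁ S₂ H₁ H₂ = joinGraph S₂ S₁ H₂ H₁ := by
  rw [joinGraph, joinGraph, sup_comm H₁, SimpleGraph.between_comm]

theorem isTARVertex_join_iff_of_subset (h₂ : EdgesIn H₂ S₂) (hd : Disjoint S₁ S₂) (hJ : J ⊆ S₁) :
    IsTARVertex (S₁ ∪ S₂) (joinGraph S₁ S₂ H₁ H₂) k J ↔ IsTARVertex S₁ H₁ k J := by
  have hn : ∀ {a}, a ∈ J → a ∉ S₂ := fun ha => Finset.disjoint_left.1 hd (hJ ha)
  constructor
  · exact fun h => ⟨hJ, fun a ha b hb hab e => h.2.1 ha hb hab (.inl (.inl e)), h.2.2⟩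
  · refine fun h => ⟨hJ.trans Finset.subset_union_left, fun a ha b hb hab e => ?_, h.2.2⟩
    rcases e with (e | e) | e
    · exact h.2.1 ha hb hab e
    · exact hn ha (h₂ _ _ e).1
    · rcases (SimpleGraph.between_adj.1 e).2 with e | e
      · exact hn hb e.2
      · exact hn ha e.1

theorem subset_or_subset_of_indepSet_join (hJ : J ⊆ S₁ ∪ S₂)
    (h : (joinGraph S₁ S₂ H₁ H₂).IsIndepSet (J : Set V)) : J ⊆ S₁ ∨ J ⊆ S₂ := by
  by_contra! hc
  obtain ⟨b, hb, hb'⟩ := Finset.not_subset.1 hc.1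
  obtain ⟨a, ha, ha'⟩ := Finset.not_subset.1 hc.2
  have hb₂ := (Finset.mem_union.1 (hJ hb)).resolve_left hb'
  have ha₁ := (Finset.mem_union.1 (hJ ha)).resolve_right ha'
  have hab : a ≠ b := fun e => hb' (e ▸ ha₁)
  exact h ha hb hab (.inr (SimpleGraph.between_adj.2 ⟨hab, .inl ⟨ha₁, hb₂⟩⟩))

/-- A token added on `S₂` would be adjacent to a token still present on `S₁`; there is one because
the level is positive. -/
theorem tarReach_join_iff (h₂ : EdgesIn H₂ S₂) (hd : Disjoint S₁ S₂) (hA : A ⊆ S₁) (hk : k ≠ 0) :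
    TARReach (S₁ ∪ S₂) (joinGraph S₁ S₂ H₁ H₂) k A J ↔ TARReach S₁ H₁ k A J := by
  constructor
  · rintro ⟨hv, -, h⟩
    induction h with
    | refl => exact ((isTARVertex_join_iff_of_subset h₂ hd hA).1 hv).refl
    | @tail J K _ hJK ih =>
      obtain ⟨hJ, hK, -, hv⟩ := hJK
      have hJS := ih.2.1.1
      have hKS : K ⊆ S₁ := by
        obtain ⟨v, rfl | rfl⟩ := hv
        · refine (subset_or_subset_of_indepSet_join hK.1 hK.2.1).resolve_right fun hc => ?_
          obtain ⟨a, ha⟩ : J.Nonempty := Finset.card_pos.1 (by have := hJ.2.2; omega)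
          exact Finset.disjoint_left.1 hd (hJS ha) (hc (Finset.mem_insert_of_mem ha))
        · exact (Finset.subset_insert v K).trans hJS
      exact ih.trans (.single ih.2.1 ((isTARVertex_join_iff_of_subset h₂ hd hKS).1 hK) hv)
  · have hv : ∀ {D}, IsTARVertex S₁ H₁ k D →
        IsTARVertex (S₁ ∪ S₂) (joinGraph S₁ S₂ H₁ H₂) k D :=
      fun hD => (isTARVertex_join_iff_of_subset h₂ hd hD.1).2 hD
    exact fun h => ⟨hv h.1, hv h.2.1, Relation.ReflTransGen.mono
      (fun _ _ e => ⟨hv e.1, hv e.2.1, e.2.2⟩) _ _ h.2.2⟩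

theorem tarMax_join (h₂ : EdgesIn H₂ S₂) (hd : Disjoint S₁ S₂) (hA : A ⊆ S₁) (hk : k ≠ 0) :
    tarMax (S₁ ∪ S₂) (joinGraph S₁ S₂ H₁ H₂) A k = tarMax S₁ H₁ A k := by
  simp only [tarMax, tarReach_join_iff h₂ hd hA hk]

/-- By `tarReach_zero` all three quantities are independence numbers, whatever the starting sets. -/
theorem tarMax_join_zero (h₁ : EdgesIn H₁ S₁) (h₂ : EdgesIn H₂ S₂) (hd : Disjoint S₁ S₂)
    (hA : IsTARVertex (S₁ ∪ S₂) (joinGraph S₁ S₂ H₁ H₂) 0 A) {A₁ A₂ : Finset V}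
    (hA₁ : IsTARVertex S₁ H₁ 0 A₁) (hA₂ : IsTARVertex S₂ H₂ 0 A₂) :
    tarMax (S₁ ∪ S₂) (joinGraph S₁ S₂ H₁ H₂) A 0 =
      max (tarMax S₁ H₁ A₁ 0) (tarMax S₂ H₂ A₂ 0) := by
  have hiff : ∀ {D}, D ⊆ S₂ → (IsTARVertex (S₁ ∪ S₂) (joinGraph S₁ S₂ H₁ H₂) 0 D ↔
      IsTARVertex S₂ H₂ 0 D) := fun hD => by
    rw [joinGraph_comm, Finset.union_comm]
    exact isTARVertex_join_iff_of_subset h₁ hd.symm hD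
  apply le_antisymm
  · obtain ⟨J, hJ, hc⟩ := hA.exists_reach_card_eq_tarMax
    rw [← hc]
    rcases subset_or_subset_of_indepSet_join hJ.2.1.1 hJ.2.1.2.1 with h | h
    · exact le_max_of_le_left (tarReach_zero hA₁
        ((isTARVertex_join_iff_of_subset h₂ hd h).1 hJ.2.1)).card_le_tarMax
    · exact le_max_of_le_right (tarReach_zero hA₂ ((hiff h).1 hJ.2.1)).card_le_tarMax
  · refine max_le ?_ ?_
    · obtain ⟨J, hJ, hc⟩ := hA₁.exists_reach_card_eq_tarMax
      exact hc ▸ (tarReach_zero hA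
        ((isTARVertex_join_iff_of_subset h₂ hd hJ.2.1.1).2 hJ.2.1)).card_le_tarMax
    · obtain ⟨J, hJ, hc⟩ := hA₂.exists_reach_card_eq_tarMax
      exact hc ▸ (tarReach_zero hA ((hiff hJ.2.1.1).2 hJ.2.1)).card_le_tarMax

end TokenAdditionRemoval

/-! ### Generalized cotrees -/

namespace GCotree

section

variable {V : Type*} [DecidableEq V] {I : Finset V}

theorem WellFormed.edgesIn {t : GCotree V} (h : t.WellFormed) : EdgesIn t.graph t.verts := by
  induction t with
  | leaf S H => exact h.2
  | node op l r ihl ihr =>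
    have hl := ihl h.1
    have hr := ihr h.2.1
    intro a b hab
    simp only [verts, Finset.mem_union]
    have key : (l.graph ⊔ r.graph).Adj a b →
        (a ∈ l.verts ∨ a ∈ r.verts) ∧ (b ∈ l.verts ∨ b ∈ r.verts) := by
      rintro (e | e)
      · exact ⟨.inl (hl _ _ e).1, .inl (hl _ _ e).2⟩
      · exact ⟨.inr (hr _ _ e).1, .inr (hr _ _ e).2⟩
    cases op with
    | union => exact key hab
    | join =>
      rcases hab with e | e
      · exact key e
      · rcases (SimpleGraph.between_adj.1 e).2 with e | e
        · exact ⟨.inl e.1, .inr e.2⟩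
        · exact ⟨.inr e.1, .inl e.2⟩

theorem WellFormed.verts_nonempty {t : GCotree V} (h : t.WellFormed) : t.verts.Nonempty := by
  induction t with
  | leaf S H => exact h.1
  | node op l r ihl _ => exact (ihl h.1).mono Finset.subset_union_left

theorem graph_le_node_left (op : NodeOp) (l r : GCotree V) : l.graph ≤ (node op l r).graph := by
  cases op with
  | union => exact le_sup_left
  | join => exact le_sup_left.trans le_sup_left

theorem graph_le_node_right (op : NodeOp) (l r : GCotree V) : r.graph ≤ (node op l r).graph := by
  cases op with
  | union => exact le_sup_right
  | join => exact le_sup_right.trans le_sup_left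

omit [DecidableEq V] in
theorem isIndepSet_of_le {H H' : SimpleGraph V} (h : H ≤ H') {s : Set V} (hs : H'.IsIndepSet s) :
    H.IsIndepSet s := fun _ ha _ hb hab e => hs ha hb hab (h e)

theorem isTARVertex_tokens {t : GCotree V} (hI : t.graph.IsIndepSet (I : Set V)) :
    IsTARVertex t.verts t.graph (t.tokens I) (I ∩ t.verts) :=
  ⟨Finset.inter_subset_right, hI.mono (Finset.coe_subset.2 Finset.inter_subset_left), le_rfl⟩

theorem tokens_node {op : NodeOp} {l r : GCotree V} (h : (node op l r).WellFormed) (I : Finset V) :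
    (node op l r).tokens I = l.tokens I + r.tokens I := by
  simp only [tokens, verts, Finset.inter_union_distrib_left]
  exact Finset.card_union_of_disjoint
    (h.2.2.mono Finset.inter_subset_right Finset.inter_subset_right)

theorem RIS_anti {t : GCotree V} (hI : t.graph.IsIndepSet (I : Set V)) {k ℓ : ℕ} (hk : ℓ ≤ k)
    (hkt : k ≤ t.tokens I) : t.RIS I k ≤ t.RIS I ℓ :=
  tarMax_anti ((isTARVertex_tokens hI).mono_level hkt) hk

theorem tokens_le_RIS {t : GCotree V} (hI : t.graph.IsIndepSet (I : Set V)) {ℓ : ℕ}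
    (hℓ : ℓ ≤ t.tokens I) : t.tokens I ≤ t.RIS I ℓ :=
  ((isTARVertex_tokens hI).mono_level hℓ).card_le_tarMax

/-- At a trivial leaf, all values `RIS^I_ℓ` are `1`. -/
theorem RIS_trivial_leaf {v : V} {H : SimpleGraph V} {ℓ : ℕ} (hℓ : ℓ ≤ (leaf {v} H).tokens I) : (leaf {v} H).RIS I ℓ = 1 := by
  have hind : ∀ J : Finset V, J ⊆ {v} → H.IsIndepSet (J : Set V) := fun J hJ a ha b hb hab _ =>
    hab ((Finset.mem_singleton.1 (hJ ha)).trans (Finset.mem_singleton.1 (hJ hb)).symm)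
  have hA : IsTARVertex {v} H ℓ (I ∩ {v}) :=
    ⟨Finset.inter_subset_right, hind _ Finset.inter_subset_right, hℓ⟩
  have hv : IsTARVertex {v} H ℓ {v} := ⟨subset_rfl, hind _ subset_rfl,
    hℓ.trans (Finset.card_le_card Finset.inter_subset_right)⟩
  apply le_antisymm
  · obtain ⟨J, hJ, hc⟩ := hA.exists_reach_card_eq_tarMax
    exact hc.symm.trans_le (Finset.card_le_card hJ.2.1.1)
  · refine TARReach.card_le_tarMax (J := {v}) (TARReach.single hA hv ⟨v, .inl ?_⟩)
    ext a; simp only [verts, Finset.mem_insert, Finset.mem_inter, Finset.mem_singleton]; tauto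

/-- `(x, y)` is the greatest `ℓ`-stable tuple. -/
def IsGreatestStable (l r : GCotree V) (I : Finset V) (ℓ x y : ℕ) : Prop :=
  l.IsStable r I ℓ x y ∧ ∀ p q, l.IsStable r I ℓ p q → p ≤ x ∧ q ≤ y

/-- A greatest element is the only maximal one. This turns the tuple found by the program into the
uniqueness that `IsOutput` demands. -/
theorem IsGreatestStable.isMaxStable_iff {l r : GCotree V} {ℓ x y : ℕ}
    (h : l.IsGreatestStable r I ℓ x y) (p q : ℕ) : l.IsMaxStable r I ℓ p q ↔ p = x ∧ q = y := by
  constructor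
  · rintro ⟨hs, hmax⟩
    obtain ⟨h1, h2⟩ := h.2 p q hs
    by_contra hne
    exact hmax ⟨x, y, h.1, h1, h2, fun e => hne (Prod.mk.inj e)⟩
  · rintro ⟨rfl, rfl⟩
    refine ⟨h.1, ?_⟩
    rintro ⟨x', y', hs, h1, h2, hne⟩
    obtain ⟨h3, h4⟩ := h.2 x' y' hs
    exact hne (by rw [le_antisymm h1 h3, le_antisymm h2 h4])

theorem RIS_union {l r : GCotree V} (hw : (node .union l r).WellFormed)
    (hI : (node .union l r).graph.IsIndepSet (I : Set V)) {ℓ x y : ℕ}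
    (hℓ : ℓ ≤ (node .union l r).tokens I) (h : l.IsGreatestStable r I ℓ x y) :
    (node .union l r).RIS I ℓ = l.RIS I x + r.RIS I y := by
  rw [tokens_node hw] at hℓ
  have hIl := isIndepSet_of_le (graph_le_node_left _ l r) hI
  have hIr := isIndepSet_of_le (graph_le_node_right _ l r) hI
  have := tarMax_union hw.1.edgesIn hw.2.1.edgesIn hw.2.2 (isTARVertex_tokens hIl)
    (isTARVertex_tokens hIr) hℓ h.1.1 h.1.2.1 h.1.2.2.1 h.1.2.2.2
    (fun p q hp hq hp' hq' => h.2 p q ⟨hp, hq, hp', hq'⟩)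
  rwa [← Finset.inter_union_distrib_left] at this

theorem tokens_join_eq_zero {l r : GCotree V} (hw : (node .join l r).WellFormed)
    (hI : (node .join l r).graph.IsIndepSet (I : Set V)) : l.tokens I = 0 ∨ r.tokens I = 0 := by
  have hv := isTARVertex_tokens hI
  simp only [tokens, Finset.card_eq_zero, ← Finset.disjoint_iff_inter_eq_empty]
  have key : ∀ {S S' : Finset V}, Disjoint S S' → I ∩ (node .join l r).verts ⊆ S →
      S' ⊆ (node .join l r).verts → Disjoint I S' := fun hd h hS =>
    Finset.disjoint_left.2 fun a ha ha' =>
      Finset.disjoint_left.1 hd (h (Finset.mem_inter.2 ⟨ha, hS ha'⟩)) ha'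
  rcases subset_or_subset_of_indepSet_join hv.1 hv.2.1 with h | h
  · exact .inr (key hw.2.2 h Finset.subset_union_right)
  · exact .inl (key hw.2.2.symm h Finset.subset_union_left)

theorem RIS_join_zero {l r : GCotree V} (hw : (node .join l r).WellFormed)
    (hI : (node .join l r).graph.IsIndepSet (I : Set V)) :
    (node .join l r).RIS I 0 = max (l.RIS I 0) (r.RIS I 0) :=
  tarMax_join_zero hw.1.edgesIn hw.2.1.edgesIn hw.2.2
    ((isTARVertex_tokens hI).mono_level (Nat.zero_le _))
    ((isTARVertex_tokens (isIndepSet_of_le (graph_le_node_left _ l r) hI)).mono_level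
      (Nat.zero_le _))
    ((isTARVertex_tokens (isIndepSet_of_le (graph_le_node_right _ l r) hI)).mono_level
      (Nat.zero_le _))

theorem RIS_join_left {l r : GCotree V} (hw : (node .join l r).WellFormed) (hr : r.tokens I = 0)
    {ℓ : ℕ} (hℓ : ℓ ≠ 0) : (node .join l r).RIS I ℓ = l.RIS I ℓ := by
  have h : I ∩ (node .join l r).verts = I ∩ l.verts := by
    rw [verts, Finset.inter_union_distrib_left, Finset.card_eq_zero.1 hr, Finset.union_empty]
  have := tarMax_join (H₁ := l.graph) hw.2.1.edgesIn hw.2.2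
    (Finset.inter_subset_right (s₁ := I)) hℓ
  rw [← h] at this
  exact this.trans (by rw [h]; rfl)

theorem RIS_join_right {l r : GCotree V} (hw : (node .join l r).WellFormed) (hl : l.tokens I = 0)
    {ℓ : ℕ} (hℓ : ℓ ≠ 0) : (node .join l r).RIS I ℓ = r.RIS I ℓ := by
  have h : I ∩ (node .join l r).verts = I ∩ r.verts := by
    rw [verts, Finset.inter_union_distrib_left, Finset.card_eq_zero.1 hl, Finset.empty_union]
  have := tarMax_join (H₁ := r.graph) hw.1.edgesIn hw.2.2.symm
    (Finset.inter_subset_right (s₁ := I)) hℓ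
  rw [joinGraph_comm, Finset.union_comm, ← h] at this
  exact this.trans (by rw [h]; rfl)

/-! ### The size of the output -/

/-- The sum of `max 1 |I ∩ V_u|` over the nodes `u`. -/
def size (I : Finset V) : GCotree V → ℕ
  | leaf S H => max 1 ((leaf S H).tokens I)
  | node op l r => max 1 ((node op l r).tokens I) + l.size I + r.size I

theorem sum_tokens_eq_size (t : GCotree V) (I : Finset V) :
    ∑ u : t.Node, max 1 ((t.sub u).tokens I) = t.size I := by
  induction t with
  | leaf S H => exact Fintype.sum_unique (ι := Unit) _
  | node op l r ihl ihr =>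
    rw [size, ← ihl, ← ihr, add_assoc]
    exact (Fintype.sum_option (α := l.Node ⊕ r.Node) _).trans
      (congrArg _ (Fintype.sum_sum_type _))

theorem WellFormed.size_le {t : GCotree V} (h : t.WellFormed) (I : Finset V) :
    t.size I ≤ t.verts.card ^ 2 := by
  have htok : ∀ t : GCotree V, t.tokens I ≤ t.verts.card := fun t =>
    Finset.card_le_card Finset.inter_subset_right
  induction t with
  | leaf S H =>
    have h1 : 1 ≤ S.card := Finset.card_pos.2 h.1
    exact (max_le h1 (htok (leaf S H))).trans (Nat.le_self_pow two_ne_zero _)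
  | node op l r ihl ihr =>
    have hl := ihl h.1
    have hr := ihr h.2.1
    have hl1 : 1 ≤ l.verts.card := Finset.card_pos.2 h.1.verts_nonempty
    have hr1 : 1 ≤ r.verts.card := Finset.card_pos.2 h.2.1.verts_nonempty
    have hc : (node op l r).verts.card = l.verts.card + r.verts.card :=
      Finset.card_union_of_disjoint h.2.2
    have hm : max 1 ((node op l r).tokens I) ≤ l.verts.card + r.verts.card :=
      max_le (by omega) (hc ▸ htok _)
    rw [hc, size]
    -- With `a, b ≥ 1` the two vertex counts, `2ab ≥ a + b` pays for the root term in `(a + b) ^ 2 =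
    -- a ^ 2 + b ^ 2 + 2ab`.
    nlinarith [Nat.mul_le_mul hl1 hr1, Nat.mul_le_mul_left l.verts.card hr1,
      Nat.mul_le_mul_right r.verts.card hl1]

end

end GCotree

/-! ### Reasoning about programs -/

namespace RAMState

@[simp] theorem setReg_reg (σ : RAMState) (d x i : ℕ) :
    (σ.setReg d x).reg i = if i = d then x else σ.reg i := by
  simp [setReg, Function.update_apply]

@[simp] theorem setReg_arr (σ : RAMState) (d x : ℕ) : (σ.setReg d x).arr = σ.arr := rfl

@[simp] theorem setArr_reg (σ : RAMState) (a i x : ℕ) : (σ.setArr a i x).reg = σ.reg := rfl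

@[simp] theorem setArr_arr (σ : RAMState) (a i x b j : ℕ) :
    (σ.setArr a i x).arr b j = if b = a ∧ j = i then x else σ.arr b j := by
  by_cases hb : b = a
  · subst hb; simp [setArr, Function.update_apply]
  · simp [setArr, hb]

end RAMState

namespace RAMProg

/-- Started in state `σ`, the program `p` halts, and the number of steps and the final state
satisfy `Q`. -/
def Terminates (p : RAMProg) (σ : RAMState) (Q : ℕ → RAMState → Prop) : Prop :=
  ∃ c τ, p.Exec σ c τ ∧ Q c τ

theorem Terminates.mono {p : RAMProg} {σ : RAMState} {Q R : ℕ → RAMState → Prop}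
    (h : p.Terminates σ Q) (hQR : ∀ c τ, Q c τ → R c τ) : p.Terminates σ R := by
  obtain ⟨c, τ, he, hQ⟩ := h
  exact ⟨c, τ, he, hQR c τ hQ⟩

section

variable {σ : RAMState} {Q : ℕ → RAMState → Prop} {p q : RAMProg} {a d i j k : ℕ}

-- The rules for instructions and blocks are simp equivalences, so `simp` runs straight-line code
-- symbolically and adds up its steps. Branches need the value of the test and are applied by hand.
@[simp] theorem terminates_skip : Terminates .skip σ Q ↔ Q 1 σ :=
  ⟨fun ⟨_, _, he, h⟩ => by cases he; exact h, fun h => ⟨_, _, .skip σ, h⟩⟩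

@[simp] theorem terminates_const : Terminates (.const d k) σ Q ↔ Q 1 (σ.setReg d k) :=
  ⟨fun ⟨_, _, he, h⟩ => by cases he; exact h, fun h => ⟨_, _, .const d k σ, h⟩⟩

@[simp] theorem terminates_add :
    Terminates (.add d i j) σ Q ↔ Q 1 (σ.setReg d (σ.reg i + σ.reg j)) :=
  ⟨fun ⟨_, _, he, h⟩ => by cases he; exact h, fun h => ⟨_, _, .add d i j σ, h⟩⟩

@[simp] theorem terminates_sub :
    Terminates (.sub d i j) σ Q ↔ Q 1 (σ.setReg d (σ.reg i - σ.reg j)) :=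
  ⟨fun ⟨_, _, he, h⟩ => by cases he; exact h, fun h => ⟨_, _, .sub d i j σ, h⟩⟩

@[simp] theorem terminates_load :
    Terminates (.load d a i) σ Q ↔ Q 1 (σ.setReg d (σ.arr a (σ.reg i))) :=
  ⟨fun ⟨_, _, he, h⟩ => by cases he; exact h, fun h => ⟨_, _, .load d a i σ, h⟩⟩

@[simp] theorem terminates_store :
    Terminates (.store a i j) σ Q ↔ Q 1 (σ.setArr a (σ.reg i) (σ.reg j)) :=
  ⟨fun ⟨_, _, he, h⟩ => by cases he; exact h, fun h => ⟨_, _, .store a i j σ, h⟩⟩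

theorem terminates_seq :
    Terminates (.seq p q) σ Q ↔ p.Terminates σ fun c τ => q.Terminates τ fun d => Q (c + d) := by
  constructor
  · rintro ⟨_, _, he, h⟩
    cases he with
    | seq he₁ he₂ => exact ⟨_, _, he₁, _, _, he₂, h⟩
  · rintro ⟨_, _, he₁, _, _, he₂, h⟩
    exact ⟨_, _, .seq he₁ he₂, h⟩

theorem terminates_cond_of_ne (hi : σ.reg i ≠ 0)
    (h : p.Terminates σ fun c => Q (c + 1)) : Terminates (.cond i p q) σ Q := by
  obtain ⟨c, τ, he, h⟩ := h
  exact ⟨_, _, .condTrue hi he, h⟩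

theorem terminates_cond_of_eq (hi : σ.reg i = 0)
    (h : q.Terminates σ fun c => Q (c + 1)) : Terminates (.cond i p q) σ Q := by
  obtain ⟨c, τ, he, h⟩ := h
  exact ⟨_, _, .condFalse hi he, h⟩

/-- Run the programs of a list one after the other. -/
def block : List RAMProg → RAMProg
  | [] => .skip
  | p :: ps => .seq p (block ps)

@[simp] theorem terminates_block_nil : (block []).Terminates σ Q ↔ Q 1 σ := terminates_skip

@[simp] theorem terminates_block_cons {ps : List RAMProg} :
    (block (p :: ps)).Terminates σ Q ↔
      p.Terminates σ fun c τ => (block ps).Terminates τ fun d => Q (c + d) := terminates_seq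

/-- A loop halts if each round decreases the natural number `μ`. -/
theorem terminates_loop (Inv : RAMState → Prop) (μ : RAMState → ℕ) (K : ℕ)
    (hstep : ∀ τ, Inv τ → τ.reg i ≠ 0 →
      p.Terminates τ fun c ρ => c ≤ K ∧ Inv ρ ∧ μ ρ < μ τ) (h : Inv σ) :
    (RAMProg.loop i p).Terminates σ fun c τ => c ≤ (K + 1) * μ σ + 1 ∧ Inv τ ∧ τ.reg i = 0 := by
  induction hn : μ σ using Nat.strong_induction_on generalizing σ with
  | _ n ih =>
    by_cases hi : σ.reg i = 0
    · exact ⟨1, σ, .loopDone hi, by omega, h, hi⟩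
    · obtain ⟨c, ρ, he, hc, hρ, hμ⟩ := hstep σ h hi
      obtain ⟨d, τ, he', hd, hτ, hτi⟩ := ih (μ ρ) (hn ▸ hμ) hρ rfl
      refine ⟨c + d + 1, τ, .loopStep hi he he', ?_, hτ, hτi⟩
      -- One round including its test costs at most `K + 1`, paid for by the decrease of `μ`.
      have := Nat.mul_le_mul_left (K + 1) (show μ ρ + 1 ≤ n by omega)
      rw [Nat.mul_add] at this
      omega

end

end RAMProg

/-- The registers in the list `s` have the same contents in the two states. -/
def RegsEq (s : List ℕ) (σ τ : RAMState) : Prop := ∀ q ∈ s, τ.reg q = σ.reg q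

@[simp] theorem regsEq_nil (σ τ : RAMState) : RegsEq [] σ τ := by simp [RegsEq]

@[simp] theorem regsEq_cons (q : ℕ) (s : List ℕ) (σ τ : RAMState) :
    RegsEq (q :: s) σ τ ↔ τ.reg q = σ.reg q ∧ RegsEq s σ τ := by simp [RegsEq]

/-! ### The program

Register `1` is the height of a stack, kept in arrays `12` (nodes) and `13` (`0` for nodes to be
visited, `1` for nodes whose children have been processed). Register `2` is the number of used
entries of the output tables. Array `14` holds the numbers of tokens of the processed nodes.
Register `3` is the current node. Registers `5` and `9` hold the constants `1` and `0`. -/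

namespace CotreeProg

open RAMProg

/-- Append to the table `outRIS` a segment of the array `a`, which starts at register `16` and whose
length is in register `17`. -/
def copyLoop (a : ℕ) : RAMProg :=
  .loop 17 (block [.load 18 a 16, .store RAMArray.outRIS 2 18, .add 2 2 5, .add 16 16 5,
    .sub 17 17 5])

/-- Process a trivial leaf. -/
def trivialLeaf : RAMProg :=
  block [.load 8 RAMArray.vertex 3, .load 8 RAMArray.member 8, .store 14 3 8,
    .store RAMArray.outStart 3 2, .store RAMArray.outRIS 2 5, .add 2 2 5,
    .store RAMArray.outRIS 2 5, .add 2 2 5]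

/-- Process a nontrivial leaf. -/
def nontrivialLeaf : RAMProg :=
  block [.load 8 RAMArray.leafTokens 3, .store 14 3 8, .store RAMArray.outStart 3 2,
    .load 16 RAMArray.leafStart 3, .add 17 8 5, copyLoop RAMArray.leafRIS]

/-- Push a nonleaf node and its children. -/
def pushChildren : RAMProg :=
  block [.add 1 1 5, .store 12 1 3, .store 13 1 5,
    .load 8 RAMArray.right 3, .add 1 1 5, .store 12 1 8, .store 13 1 9,
    .load 8 RAMArray.left 3, .add 1 1 5, .store 12 1 8, .store 13 1 9]

/-- Compute the maximum stable tuples of a union node. Registers `8` and `10` hold the current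
tuple, register `15` is one more than the current level, and registers `11` and `12` are the starts
of the tables of the children. -/
def unionLoop : RAMProg :=
  .loop 15 (block [.sub 16 15 5, .add 17 12 10, .load 17 RAMArray.outRIS 17, .sub 18 16 17,
    .sub 19 8 18,
    .cond 19 (.add 8 18 9) (block [.add 20 11 8, .load 20 RAMArray.outRIS 20, .sub 21 16 20,
      .sub 22 10 21,
      .cond 22 (.add 10 21 9) (block [.add 20 20 17, .add 16 2 16, .store RAMArray.outRIS 16 20,
        .store RAMArray.outX 16 8, .store RAMArray.outY 16 10, .sub 15 15 5])])])

/-- Process a union node. -/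
def unionNode : RAMProg :=
  block [.add 15 13 5, unionLoop, .add 2 2 13, .add 2 2 5]

/-- Process a join node. -/
def joinNode : RAMProg :=
  block [.cond 10 (block [.add 16 12 9, .add 18 11 9]) (block [.add 16 11 9, .add 18 12 9]),
    .load 19 RAMArray.outRIS 16, .load 18 RAMArray.outRIS 18, .sub 18 18 19, .add 18 18 19,
    .store RAMArray.outRIS 2 18, .add 2 2 5, .add 16 16 5, .add 17 13 9,
    copyLoop RAMArray.outRIS]

/-- Process a nonleaf node whose children have been processed. -/
def combine : RAMProg :=
  block [.load 6 RAMArray.left 3, .load 7 RAMArray.right 3, .load 8 14 6, .load 10 14 7,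
    .load 11 RAMArray.outStart 6, .load 12 RAMArray.outStart 7, .add 13 8 10, .store 14 3 13,
    .store RAMArray.outStart 3 2, .load 14 RAMArray.kind 3, .const 15 2, .sub 14 14 15,
    .cond 14 joinNode unionNode]

/-- Visit a node. -/
def visit : RAMProg :=
  block [.load 6 RAMArray.kind 3, .sub 7 6 5,
    .cond 7 pushChildren (.cond 6 nontrivialLeaf trivialLeaf)]

/-- Process the top of the stack. -/
def mainBody : RAMProg :=
  block [.load 3 12 1, .load 4 13 1, .sub 1 1 5, .cond 4 combine visit]

/-- The algorithm. -/
def prog : RAMProg :=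
  block [.const 1 1, .const 2 0, .const 5 1, .const 9 0, .store 12 1 0, .store 13 1 9,
    .loop 1 mainBody]

/-! ### Correctness of the parts -/

/-- `τ` arises from `σ` by writing output for nodes in `N`, and keeping the stack up to `b`. -/
structure Frame (N : Set ℕ) (b : ℕ) (σ τ : RAMState) : Prop where
  input : ∀ a < 8, ∀ i, τ.arr a i = σ.arr a i
  heap : σ.reg 2 ≤ τ.reg 2
  out : ∀ i < σ.reg 2,
    τ.arr 9 i = σ.arr 9 i ∧ τ.arr 10 i = σ.arr 10 i ∧ τ.arr 11 i = σ.arr 11 i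
  node : ∀ i ∉ N, τ.arr 8 i = σ.arr 8 i ∧ τ.arr 14 i = σ.arr 14 i
  stack : ∀ i ≤ b, τ.arr 12 i = σ.arr 12 i ∧ τ.arr 13 i = σ.arr 13 i
  one : τ.reg 5 = σ.reg 5
  zero : τ.reg 9 = σ.reg 9

theorem Frame.mono {N N' : Set ℕ} {b b' : ℕ} {σ τ : RAMState} (h : Frame N b σ τ) (hN : N ⊆ N')
    (hb : b' ≤ b) : Frame N' b' σ τ :=
  { h with
    node := fun i hi => h.node i fun hi' => hi (hN hi')
    stack := fun i hi => h.stack i (hi.trans hb) }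

theorem Frame.trans {N : Set ℕ} {b : ℕ} {σ τ ρ : RAMState} (h : Frame N b σ τ)
    (h' : Frame N b τ ρ) : Frame N b σ ρ where
  input a ha i := (h'.input a ha i).trans (h.input a ha i)
  heap := h.heap.trans h'.heap
  out i hi := by
    have h1 := h.out i hi
    have h2 := h'.out i (hi.trans_le h.heap)
    exact ⟨h2.1.trans h1.1, h2.2.1.trans h1.2.1, h2.2.2.trans h1.2.2⟩
  node i hi := ⟨(h'.node i hi).1.trans (h.node i hi).1, (h'.node i hi).2.trans (h.node i hi).2⟩
  stack i hi := ⟨(h'.stack i hi).1.trans (h.stack i hi).1, (h'.stack i hi).2.trans (h.stack i hi).2⟩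
  one := h'.one.trans h.one
  zero := h'.zero.trans h.zero

/-- The output for node number `m`, the root of `t`, is in place. -/
structure Done {V : Type*} [DecidableEq V] (t : GCotree V) (I : Finset V) (m : ℕ)
    (σ : RAMState) : Prop where
  tok : σ.arr 14 m = t.tokens I
  bound : σ.arr 8 m + t.tokens I < σ.reg 2
  ris : ∀ ℓ ≤ t.tokens I, σ.arr 9 (σ.arr 8 m + ℓ) = t.RIS I ℓ
  stable : ∀ l r, t = .node .union l r → ∀ ℓ ≤ t.tokens I,
    l.IsGreatestStable r I ℓ (σ.arr 10 (σ.arr 8 m + ℓ)) (σ.arr 11 (σ.arr 8 m + ℓ))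

/-- The tables of a finished node lie below the heap pointer in register `2`, where nothing is
written again. -/
theorem Done.frame {V : Type*} [DecidableEq V] {t : GCotree V} {I : Finset V} {m : ℕ}
    {σ τ : RAMState} (h : Done t I m σ) {N : Set ℕ} {b : ℕ} (hf : Frame N b σ τ) (hm : m ∉ N) :
    Done t I m τ := by
  obtain ⟨h8, h14⟩ := hf.node m hm
  have hlt : ∀ ℓ ≤ t.tokens I, σ.arr 8 m + ℓ < σ.reg 2 := fun ℓ hℓ =>
    (Nat.add_le_add_left hℓ _).trans_lt h.bound
  refine ⟨h14.trans h.tok, h8 ▸ h.bound.trans_le hf.heap, fun ℓ hℓ => ?_, fun l r ht ℓ hℓ => ?_⟩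
  · rw [h8, (hf.out _ (hlt ℓ hℓ)).1, h.ris ℓ hℓ]
  · rw [h8, (hf.out _ (hlt ℓ hℓ)).2.1, (hf.out _ (hlt ℓ hℓ)).2.2]
    exact h.stable l r ht ℓ hℓ

/-- When `outRIS` is copied onto itself, `ha` places the source below the heap pointer, so it is not
overwritten during the copy. -/
theorem copyLoop_terminates {a : ℕ} {σ : RAMState} {g : ℕ → ℕ} (h5 : σ.reg 5 = 1)
    (hg : ∀ j < σ.reg 17, σ.arr a (σ.reg 16 + j) = g j)
    (ha : a = 9 → σ.reg 16 + σ.reg 17 ≤ σ.reg 2) :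
    (copyLoop a).Terminates σ fun c τ => c ≤ 7 * σ.reg 17 + 1 ∧ RegsEq [1, 3, 5, 9] σ τ ∧
      τ.reg 2 = σ.reg 2 + σ.reg 17 ∧ (∀ b, b ≠ 9 → ∀ i, τ.arr b i = σ.arr b i) ∧
      (∀ i < σ.reg 2, τ.arr 9 i = σ.arr 9 i) ∧
      ∀ j < σ.reg 17, τ.arr 9 (σ.reg 2 + j) = g j := by
  -- A round costs `6`: five instructions and the closing `skip` of the block.
  refine (terminates_loop (σ := σ) (fun τ => RegsEq [1, 3, 5, 9] σ τ ∧ τ.reg 17 ≤ σ.reg 17 ∧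
    τ.reg 2 + τ.reg 17 = σ.reg 2 + σ.reg 17 ∧ τ.reg 16 + τ.reg 17 = σ.reg 16 + σ.reg 17 ∧
    (∀ b, b ≠ 9 → ∀ i, τ.arr b i = σ.arr b i) ∧ (∀ i < σ.reg 2, τ.arr 9 i = σ.arr 9 i) ∧
    ∀ j < σ.reg 17 - τ.reg 17, τ.arr 9 (σ.reg 2 + j) = g j) (fun τ => τ.reg 17) 6 ?_ ?_).mono ?_
  · rintro τ ⟨hr, h17, h2, h16, hb, hlo, hhi⟩ hne
    simp only [regsEq_cons, regsEq_nil, and_true] at hr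
    have hval : τ.arr a (τ.reg 16) = g (σ.reg 17 - τ.reg 17) := by
      have e : τ.reg 16 = σ.reg 16 + (σ.reg 17 - τ.reg 17) := by omega
      rw [← hg _ (by omega), ← e]
      by_cases h9 : a = 9
      · subst h9
        exact hlo _ (by have := ha rfl; omega)
      · exact hb a h9 _
    simp [hr, h5, hval]
    refine ⟨⟨by omega, by omega, by omega, fun b hb9 i => ?_, fun i hi => ?_, fun j hj => ?_⟩,
      by omega⟩
    · simp [hb9, hb b hb9 i]
    · rw [if_neg (by omega), hlo i hi]
    · split_ifs with hj'
      · congr 1; omega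
      · exact hhi j (by omega)
  · simp
  · rintro c τ ⟨hc, ⟨hr, h17, h2, h16, hb, hlo, hhi⟩, h0⟩
    exact ⟨by omega, hr, by omega, hb, hlo, fun j hj => hhi j (by omega)⟩

/-! ### Processing single nodes. -/

variable {V : Type*} [DecidableEq V] {I : Finset V} {σ : RAMState} {m : ℕ}

/-- Two entries `1` are written whether or not the vertex carries a token, which avoids a case
distinction; without a token the second is mere padding. -/
theorem trivialLeaf_terminates {v : V} {H : SimpleGraph V} {vnum : V → ℕ} (b : ℕ)
    (h5 : σ.reg 5 = 1) (hm : σ.reg 3 = m) (hv : σ.arr 3 m = vnum v)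
    (hI : σ.arr 4 (vnum v) = if v ∈ I then 1 else 0) :
    trivialLeaf.Terminates σ fun c τ => c ≤ 20 ∧ τ.reg 1 = σ.reg 1 ∧ Frame {m} b σ τ ∧
      Done (.leaf {v} H) I m τ := by
  have htok : (GCotree.leaf {v} H).tokens I = if v ∈ I then 1 else 0 := by
    by_cases h : v ∈ I <;> simp [GCotree.tokens, GCotree.verts, h]
  have hle : (GCotree.leaf {v} H).tokens I ≤ 1 := by rw [htok]; split_ifs <;> simp
  simp [trivialLeaf, h5, hm, hv, hI]
  refine ⟨⟨?_, ?_, ?_, ?_, ?_, ?_, ?_⟩, ⟨?_, ?_, ?_, ?_⟩⟩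
  · intro a ha i
    simp [show a ≠ 9 by omega, show a ≠ 8 by omega, show a ≠ 14 by omega]
  · simp; omega
  · intro i hi
    simp [show i ≠ σ.reg 2 by omega, show i ≠ σ.reg 2 + 1 by omega]
  · intro i hi
    have : i ≠ m := hi
    simp [this]
  · simp
  · simp [h5]
  · simp
  · simp [htok]
  · simp; omega
  · intro ℓ hℓ
    rw [GCotree.RIS_trivial_leaf hℓ]
    have : ℓ = 0 ∨ ℓ = 1 := by omega
    rcases this with rfl | rfl <;> simp
  · simp

theorem nontrivialLeaf_terminates {S : Finset V} {H : SimpleGraph V} (b : ℕ)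
    (h5 : σ.reg 5 = 1) (hm : σ.reg 3 = m) (htok : σ.arr 5 m = (GCotree.leaf S H).tokens I)
    (hris : ∀ ℓ ≤ (GCotree.leaf S H).tokens I,
      σ.arr 7 (σ.arr 6 m + ℓ) = (GCotree.leaf S H).RIS I ℓ) :
    nontrivialLeaf.Terminates σ fun c τ => c ≤ 7 * (GCotree.leaf S H).tokens I + 20 ∧
      τ.reg 1 = σ.reg 1 ∧ Frame {m} b σ τ ∧ Done (.leaf S H) I m τ := by
  simp [nontrivialLeaf, h5, hm, htok]
  refine (copyLoop_terminates (g := (GCotree.leaf S H).RIS I) (by simpa using h5) ?_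
    (by simp)).mono ?_
  · intro j hj
    simpa using hris j (by simpa [Nat.lt_succ_iff] using hj)
  · rintro c τ ⟨hc, hr, h2, hb, hlo, hhi⟩
    simp at hc hr h2 hb hlo hhi
    obtain ⟨hr1, hr3, hr5, hr9⟩ := hr
    refine ⟨by omega, hr1, ⟨?_, ?_, ?_, ?_, ?_, ?_, ?_⟩, ⟨?_, ?_, ?_, ?_⟩⟩
    · intro a ha i
      simp [hb a (show a ≠ 9 by omega), show a ≠ 8 by omega, show a ≠ 14 by omega]
    · omega
    · intro i hi
      simp [hb, hlo i hi]
    · intro i hi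
      have : i ≠ m := hi
      simp [hb, this]
    · simp [hb]
    · exact hr5
    · exact hr9
    · simp [hb]
    · simp [hb]; omega
    · intro ℓ hℓ
      simp [hb, hhi ℓ hℓ]
    · simp

/-- The node goes back below its children, marked `1`, so that it resurfaces when both are finished.
The left child is on top. -/
theorem pushChildren_terminates (h5 : σ.reg 5 = 1) (h9 : σ.reg 9 = 0) (hm : σ.reg 3 = m) :
    pushChildren.Terminates σ fun c τ => c ≤ 20 ∧ τ.reg 1 = σ.reg 1 + 3 ∧
      Frame ∅ (σ.reg 1) σ τ ∧ τ.arr 12 (σ.reg 1 + 1) = m ∧ τ.arr 13 (σ.reg 1 + 1) = 1 ∧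
      τ.arr 12 (σ.reg 1 + 2) = σ.arr 2 m ∧ τ.arr 13 (σ.reg 1 + 2) = 0 ∧
      τ.arr 12 (σ.reg 1 + 3) = σ.arr 1 m ∧ τ.arr 13 (σ.reg 1 + 3) = 0 := by
  simp [pushChildren, h5, h9, hm]
  refine ⟨?_, ?_, ?_, ?_, ?_, ?_, ?_⟩
  · intro a ha i
    simp [show a ≠ 12 by omega, show a ≠ 13 by omega]
  · simp
  · simp
  · simp
  · intro i hi
    simp [show i ≠ σ.reg 1 + 1 by omega, show i ≠ σ.reg 1 + 1 + 1 by omega,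
      show i ≠ σ.reg 1 + 1 + 1 + 1 by omega]
  · simp [h5]
  · simp [h9]

/-- What holds between the rounds of `unionLoop`, which was started in state `σ`. -/
structure UnionInv (l r : GCotree V) (I : Finset V) (σ τ : RAMState) : Prop where
  regs : RegsEq [1, 2, 3, 5, 9, 11, 12, 13] σ τ
  level : τ.reg 15 ≤ l.tokens I + r.tokens I + 1
  le_left : τ.reg 8 ≤ l.tokens I
  le_right : τ.reg 10 ≤ r.tokens I
  left_ge : τ.reg 15 - 1 - r.RIS I (τ.reg 10) ≤ τ.reg 8
  right_ge : τ.reg 15 - 1 - l.RIS I (τ.reg 8) ≤ τ.reg 10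
  ub : ∀ ℓ < τ.reg 15, ∀ p q, l.IsStable r I ℓ p q → p ≤ τ.reg 8 ∧ q ≤ τ.reg 10
  arrs : ∀ a, a ≠ 9 → a ≠ 10 → a ≠ 11 → ∀ i, τ.arr a i = σ.arr a i
  out : ∀ i < σ.reg 2,
    τ.arr 9 i = σ.arr 9 i ∧ τ.arr 10 i = σ.arr 10 i ∧ τ.arr 11 i = σ.arr 11 i
  done : ∀ ℓ ≤ l.tokens I + r.tokens I, τ.reg 15 ≤ ℓ →
    l.IsGreatestStable r I ℓ (τ.arr 10 (σ.reg 2 + ℓ)) (τ.arr 11 (σ.reg 2 + ℓ)) ∧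
    τ.arr 9 (σ.reg 2 + ℓ) =
      l.RIS I (τ.arr 10 (σ.reg 2 + ℓ)) + r.RIS I (τ.arr 11 (σ.reg 2 + ℓ))

/-- Fields `left_ge` and `right_ge` are one half of stability at level `reg 15 - 1`; the failed
tests supply the other half, and `ub` then makes the pair greatest. As `ub` covers all remaining
levels, the pair need not be reset when the level drops, and this makes the total cost linear. -/
theorem unionLoop_terminates {l r : GCotree V} (hIl : l.graph.IsIndepSet (I : Set V))
    (hIr : r.graph.IsIndepSet (I : Set V)) (h5 : σ.reg 5 = 1) (h9 : σ.reg 9 = 0)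
    (h8 : σ.reg 8 = l.tokens I) (h10 : σ.reg 10 = r.tokens I)
    (h15 : σ.reg 15 = l.tokens I + r.tokens I + 1)
    (hl : ∀ x ≤ l.tokens I, σ.reg 11 + x < σ.reg 2 ∧ σ.arr 9 (σ.reg 11 + x) = l.RIS I x)
    (hr : ∀ y ≤ r.tokens I, σ.reg 12 + y < σ.reg 2 ∧ σ.arr 9 (σ.reg 12 + y) = r.RIS I y) :
    unionLoop.Terminates σ fun c τ => c ≤ 50 * (l.tokens I + r.tokens I + 1) + 1 ∧
      UnionInv l r I σ τ ∧ τ.reg 15 = 0 := by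
  -- The measure starts at twice the token count plus `1`, and a round with its test costs at most
  -- `25`; hence the factor `50`.
  refine (terminates_loop (σ := σ) (UnionInv l r I σ)
    (fun τ => τ.reg 15 + τ.reg 8 + τ.reg 10) 24 ?_ ?_).mono ?_
  · intro τ hτ hne
    have hregs := hτ.regs
    simp only [regsEq_cons, regsEq_nil, and_true] at hregs
    obtain ⟨r1, r2, r3, r5, r9, r11, r12, r13⟩ := hregs
    have hRy : τ.arr 9 (σ.reg 12 + τ.reg 10) = r.RIS I (τ.reg 10) := by
      rw [(hτ.out _ (hr _ hτ.le_right).1).1, (hr _ hτ.le_right).2]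
    have hRx : τ.arr 9 (σ.reg 11 + τ.reg 8) = l.RIS I (τ.reg 8) := by
      rw [(hτ.out _ (hl _ hτ.le_left).1).1, (hl _ hτ.le_left).2]
    have e8 := hτ.le_left
    have e10 := hτ.le_right
    have e15 := hτ.level
    have eL := hτ.left_ge
    have eR := hτ.right_ge
    simp [r5, h5, r12, hRy]
    by_cases hx : τ.reg 8 - (τ.reg 15 - 1 - r.RIS I (τ.reg 10)) = 0
    · refine terminates_cond_of_eq (by simpa using hx) ?_
      simp [r11, hRx]
      by_cases hy : τ.reg 10 - (τ.reg 15 - 1 - l.RIS I (τ.reg 8)) = 0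
      · refine terminates_cond_of_eq (by simpa using hy) ?_
        have hst : l.IsGreatestStable r I (τ.reg 15 - 1) (τ.reg 8) (τ.reg 10) :=
          ⟨⟨e8, e10, by omega, by omega⟩, hτ.ub _ (by omega)⟩
        simp [r5, h5, r2]
        refine ⟨⟨?_, ?_, ?_, ?_, ?_, ?_, ?_, ?_, ?_, ?_⟩, by omega⟩
        · simp [*]
        · simp; omega
        · simpa using e8
        · simpa using e10
        · simp; omega
        · simp; omega
        · intro ℓ hℓ p q hs
          simpa using hτ.ub ℓ (by simp at hℓ; omega) p q hs
        · intro a ha9 ha10 ha11 i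
          simp [ha9, ha10, ha11, hτ.arrs]
        · intro i hi
          simpa [show i ≠ σ.reg 2 + (τ.reg 15 - 1) by omega] using hτ.out i hi
        · intro ℓ hℓ hle
          simp at hle
          by_cases hc : ℓ = τ.reg 15 - 1
          · subst hc
            simpa using hst
          · simpa [hc] using hτ.done ℓ hℓ (by omega)
      · refine terminates_cond_of_ne (by simpa using hy) ?_
        simp [r9, h9]
        refine ⟨⟨?_, ?_, ?_, ?_, ?_, ?_, ?_, ?_, ?_, ?_⟩, by omega⟩
        · simp [*]
        · simpa using e15
        · simpa using e8
        · simp; omega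
        · have := GCotree.RIS_anti hIr
            (show τ.reg 15 - 1 - l.RIS I (τ.reg 8) ≤ τ.reg 10 by omega) e10
          simp; omega
        · simp
        · intro ℓ hℓ p q hs
          simp at hℓ
          obtain ⟨hp, hq⟩ := hτ.ub ℓ hℓ p q hs
          -- For a stable `(p, q)` at a level below `reg 15`, `p ≤ x` gives `R₁ x ≤ R₁ p`, so `q = ℓ
          -- - R₁ p` does not exceed the lowered second coordinate.
          have := GCotree.RIS_anti hIl hp e8
          have := hs.2.2.2
          simp; omega
        · simpa using hτ.arrs
        · simpa using hτ.out
        · simpa using hτ.done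
    · refine terminates_cond_of_ne (by simpa using hx) ?_
      simp [r9, h9]
      refine ⟨⟨?_, ?_, ?_, ?_, ?_, ?_, ?_, ?_, ?_, ?_⟩, by omega⟩
      · simp [*]
      · simpa using e15
      · simp; omega
      · simpa using e10
      · simp
      · have := GCotree.RIS_anti hIl
          (show τ.reg 15 - 1 - r.RIS I (τ.reg 10) ≤ τ.reg 8 by omega) e8
        simp; omega
      · intro ℓ hℓ p q hs
        simp at hℓ
        obtain ⟨hp, hq⟩ := hτ.ub ℓ hℓ p q hs
        have := GCotree.RIS_anti hIr hq e10
        have := hs.2.2.1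
        simp; omega
      · simpa using hτ.arrs
      · simpa using hτ.out
      · simpa using hτ.done
  -- At the top level the token counts satisfy the inequalities, because each side can hold at least
  -- its own tokens.
  · have hl' := GCotree.tokens_le_RIS hIl le_rfl
    have hr' := GCotree.tokens_le_RIS hIr le_rfl
    refine ⟨by simp, h15.le, h8.le, h10.le, ?_, ?_, ?_, by simp, by simp, ?_⟩
    · rw [h10]; omega
    · rw [h8]; omega
    · rw [h8, h10]; exact fun ℓ _ p q hs => ⟨hs.1, hs.2.1⟩
    · intro ℓ hℓ hle; omega
  · rintro c τ ⟨hc, hτ, h0⟩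
    exact ⟨by omega, hτ, h0⟩

theorem combine_terminates_union {l r : GCotree V} (b : ℕ)
    (hw : (GCotree.node .union l r).WellFormed)
    (hI : (GCotree.node .union l r).graph.IsIndepSet (I : Set V))
    (h5 : σ.reg 5 = 1) (h9 : σ.reg 9 = 0) (hm : σ.reg 3 = m) (hk : σ.arr 0 m = 2)
    (hl : Done l I (σ.arr 1 m) σ) (hr : Done r I (σ.arr 2 m) σ) :
    combine.Terminates σ fun c τ =>
      c ≤ 50 * ((GCotree.node .union l r).tokens I + 1) + 40 ∧
      τ.reg 1 = σ.reg 1 ∧ Frame {m} b σ τ ∧ Done (.node .union l r) I m τ := by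
  have hIl := GCotree.isIndepSet_of_le (GCotree.graph_le_node_left _ l r) hI
  have hIr := GCotree.isIndepSet_of_le (GCotree.graph_le_node_right _ l r) hI
  have htok := GCotree.tokens_node hw I
  simp [combine, hm, hl.tok, hr.tok, hk]
  refine terminates_cond_of_eq (by simp) ?_
  simp [unionNode, h5]
  refine (unionLoop_terminates hIl hIr (by simpa using h5) (by simpa using h9) (by simp) (by simp)
    (by simp) ?_ ?_).mono ?_
  · intro x hx
    simpa using ⟨(Nat.add_le_add_left hx _).trans_lt hl.bound, hl.ris x hx⟩
  · intro y hy
    simpa using ⟨(Nat.add_le_add_left hy _).trans_lt hr.bound, hr.ris y hy⟩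
  · rintro c τ ⟨hc, hτ, h0⟩
    obtain ⟨hregs, -, -, -, -, -, -, harr, hout, hdone⟩ := hτ
    simp at hregs harr hout hdone
    obtain ⟨r1, r2, r3, r5, r9, r11, r12, r13⟩ := hregs
    simp [r1, r2, r5, r13, h5]
    have h8 : τ.arr 8 m = σ.reg 2 := by simp [harr]
    refine ⟨by omega, ⟨?_, ?_, ?_, ?_, ?_, ?_, ?_⟩, ⟨?_, ?_, ?_, ?_⟩⟩
    · intro a ha i
      simp [harr a (by omega) (by omega) (by omega), show a ≠ 8 by omega, show a ≠ 14 by omega]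
    · simp; omega
    · simpa using hout
    · intro i hi
      have : i ≠ m := hi
      simp [harr, this]
    · simp [harr]
    · simp [r5]
    · simp [r9]
    · simp [harr, htok]
    · simp [h8, htok]
    · intro ℓ hℓ
      obtain ⟨hs, he⟩ := hdone ℓ (htok ▸ hℓ) (by omega)
      rw [GCotree.RIS_union hw hI hℓ hs]
      simpa [h8] using he
    · rintro l' r' ⟨⟩ ℓ hℓ
      simpa [h8] using (hdone ℓ (htok ▸ hℓ) (by omega)).1

theorem combine_terminates_join {l r : GCotree V} (b : ℕ)
    (hw : (GCotree.node .join l r).WellFormed)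
    (hI : (GCotree.node .join l r).graph.IsIndepSet (I : Set V))
    (h5 : σ.reg 5 = 1) (h9 : σ.reg 9 = 0) (hm : σ.reg 3 = m) (hk : σ.arr 0 m = 3)
    (hl : Done l I (σ.arr 1 m) σ) (hr : Done r I (σ.arr 2 m) σ) :
    combine.Terminates σ fun c τ =>
      c ≤ 50 * ((GCotree.node .join l r).tokens I + 1) + 40 ∧
      τ.reg 1 = σ.reg 1 ∧ Frame {m} b σ τ ∧ Done (.node .join l r) I m τ := by
  have htok := GCotree.tokens_node hw I
  have h0 := GCotree.tokens_join_eq_zero hw hI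
  have hR0 := GCotree.RIS_join_zero hw hI
  have hbl := hl.bound
  have hbr := hr.bound
  have hl0 := hl.ris 0 (Nat.zero_le _)
  have hr0 := hr.ris 0 (Nat.zero_le _)
  simp only [add_zero] at hl0 hr0
  -- the copy loop, whichever child carries the tokens
  have finish : ∀ {τ : RAMState}, τ.reg 1 = σ.reg 1 → τ.reg 2 = σ.reg 2 + 1 →
      τ.reg 5 = 1 → τ.reg 9 = 0 → τ.reg 17 = (GCotree.node .join l r).tokens I →
      (∀ a i, τ.arr a i = if a = 9 ∧ i = σ.reg 2 then (GCotree.node .join l r).RIS I 0 else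
        if a = 8 ∧ i = m then σ.reg 2 else
        if a = 14 ∧ i = m then (GCotree.node .join l r).tokens I else σ.arr a i) →
      (∀ j < (GCotree.node .join l r).tokens I,
        τ.arr 9 (τ.reg 16 + j) = (GCotree.node .join l r).RIS I (j + 1)) →
      τ.reg 16 + (GCotree.node .join l r).tokens I ≤ σ.reg 2 →
      (copyLoop 9).Terminates τ fun c ρ =>
        c ≤ 7 * (GCotree.node .join l r).tokens I + 1 ∧
        ρ.reg 1 = σ.reg 1 ∧ Frame {m} b σ ρ ∧ Done (.node .join l r) I m ρ := by
    intro τ t1 t2 t5 t9 t17 tarr tg t16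
    refine (copyLoop_terminates (g := fun j => (GCotree.node .join l r).RIS I (j + 1)) t5
      (fun j hj => tg j (t17 ▸ hj)) (by omega)).mono ?_
    rintro c ρ ⟨hc, hregs, h2, hb, hlo, hhi⟩
    simp only [regsEq_cons, regsEq_nil, and_true] at hregs
    obtain ⟨r1, r3, r5, r9⟩ := hregs
    rw [t2] at h2 hlo hhi
    rw [t17] at hc h2 hhi
    have h8 : ρ.arr 8 m = σ.reg 2 := by simp [hb, tarr]
    refine ⟨hc, r1.trans t1, ⟨?_, ?_, ?_, ?_, ?_, ?_, ?_⟩, ⟨?_, ?_, ?_, ?_⟩⟩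
    · intro a ha i
      simp [hb a (by omega), tarr, show a ≠ 8 by omega, show a ≠ 9 by omega,
        show a ≠ 14 by omega]
    · omega
    · intro i hi
      simp [hb, hlo i (by omega), tarr, hi.ne]
    · intro i hi
      have : i ≠ m := hi
      simp [hb, tarr, this]
    · simp [hb, tarr]
    · rw [r5, t5, h5]
    · rw [r9, t9, h9]
    · simp [hb, tarr]
    · omega
    · intro ℓ hℓ
      rw [h8]
      rcases ℓ with _ | j
      · simp [hlo (σ.reg 2) (by omega), tarr]
      · rw [← hhi j hℓ]
        congr 1; omega
    · rintro l' r' ⟨⟩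
  simp [combine, hm, hl.tok, hr.tok, hk]
  refine terminates_cond_of_ne (by simp) ?_
  simp only [joinNode, terminates_block_cons, terminates_block_nil]
  by_cases hr1 : r.tokens I = 0
  · refine terminates_cond_of_eq (by simpa using hr1) ?_
    simp [h5, h9, hl0, hr0]
    refine (finish ?_ ?_ ?_ ?_ ?_ ?_ ?_ ?_).mono ?_
    · simp
    · simp
    · simp [h5]
    · simp [h9]
    · simp [htok]
    -- With truncated subtraction `a - b + b` is `max a b`, the value at level `0`.
    · intro a i
      simp [htok, hR0, Nat.max_def]
      split_ifs <;> omega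
    -- The copy starts at level `1`, because entry `0` is the maximum just written.
    · intro j hj
      rw [htok, hr1, add_zero] at hj
      rw [GCotree.RIS_join_left hw hr1 (Nat.succ_ne_zero j), ← hl.ris _ hj]
      simp [RAMArray.outStart, RAMArray.left, RAMArray.right, add_assoc, add_comm 1 j]
      omega
    · simp [RAMArray.outStart, RAMArray.left, RAMArray.right]; omega
    · rintro c ρ ⟨hc, h⟩
      exact ⟨by omega, by simpa using h⟩
  · have hl1 : l.tokens I = 0 := h0.resolve_right hr1
    refine terminates_cond_of_ne (by simpa using hr1) ?_
    simp [h5, h9, hl0, hr0]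
    refine (finish ?_ ?_ ?_ ?_ ?_ ?_ ?_ ?_).mono ?_
    · simp
    · simp
    · simp [h5]
    · simp [h9]
    · simp [htok]
    · intro a i
      simp [htok, hR0, Nat.max_def]
      split_ifs <;> omega
    · intro j hj
      rw [htok, hl1, zero_add] at hj
      rw [GCotree.RIS_join_right hw hl1 (Nat.succ_ne_zero j), ← hr.ris _ hj]
      simp [RAMArray.outStart, RAMArray.left, RAMArray.right, add_assoc, add_comm 1 j]
      omega
    · simp [RAMArray.outStart, RAMArray.left, RAMArray.right]; omega
    · rintro c ρ ⟨hc, h⟩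
      exact ⟨by omega, by simpa using h⟩

/-! ### The traversal of the tree -/

/-- The main loop runs from `σ` to `τ` in `n` steps. -/
def Reaches (σ : RAMState) (n : ℕ) (τ : RAMState) : Prop :=
  ∀ d ρ, (RAMProg.loop 1 mainBody).Exec τ d ρ → (RAMProg.loop 1 mainBody).Exec σ (n + d) ρ

theorem Reaches.trans {σ τ ρ : RAMState} {n k : ℕ} (h : Reaches σ n τ) (h' : Reaches τ k ρ) :
    Reaches σ (n + k) ρ := fun d υ he => by
  rw [add_assoc]
  exact h _ _ (h' _ _ he)

theorem reaches_of_terminates {σ : RAMState} {Q : ℕ → RAMState → Prop} (hs : σ.reg 1 ≠ 0)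
    (h : mainBody.Terminates σ Q) : ∃ n τ, Reaches σ (n + 1) τ ∧ Q n τ := by
  obtain ⟨c, τ, he, hQ⟩ := h
  refine ⟨c, τ, fun d ρ he' => ?_, hQ⟩
  rw [add_right_comm]
  exact .loopStep hs he he'

theorem storedIn_congr {σ τ : RAMState} (h : ∀ a < 8, ∀ i, τ.arr a i = σ.arr a i) {vnum : V → ℕ}
    {t : GCotree V} {num : t.Node → ℕ} (hs : t.StoredIn σ I vnum num) :
    t.StoredIn τ I vnum num := by
  have e : ∀ a < 8, τ.arr a = σ.arr a := fun a ha => funext (h a ha)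
  induction t with
  | leaf S H =>
    unfold GCotree.StoredIn at hs ⊢
    rwa [e RAMArray.kind (by decide), e RAMArray.vertex (by decide),
      e RAMArray.leafTokens (by decide), e RAMArray.leafRIS (by decide),
      e RAMArray.leafStart (by decide)]
  | node op l r ihl ihr =>
    obtain ⟨h1, h2, h3, h4, h5⟩ := hs
    exact ⟨(h _ (by decide) _).trans h1, (h _ (by decide) _).trans h2,
      (h _ (by decide) _).trans h3, ihl h4, ihr h5⟩

/-- Pop a node that is to be visited. -/
theorem mainBody_terminates_visit {σ : RAMState} {s m : ℕ} {Q : ℕ → RAMState → Prop}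
    (h5 : σ.reg 5 = 1) (h1 : σ.reg 1 = s + 1) (h12 : σ.arr 12 (s + 1) = m)
    (h13 : σ.arr 13 (s + 1) = 0)
    (h : ∀ τ : RAMState, τ.arr = σ.arr → τ.reg 1 = s → τ.reg 2 = σ.reg 2 → τ.reg 3 = m →
      τ.reg 5 = 1 → τ.reg 9 = σ.reg 9 → visit.Terminates τ fun c => Q (c + 5)) :
    mainBody.Terminates σ Q := by
  simp [mainBody, h1, h12, h13, h5]
  refine terminates_cond_of_eq (by simp) ?_
  refine (h _ (by simp) (by simp) (by simp) (by simp) (by simp [h5]) (by simp)).mono ?_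
  intro c τ hQ
  convert hQ using 1
  omega

/-- Pop a node whose children have been processed. -/
theorem mainBody_terminates_combine {σ : RAMState} {s m : ℕ} {Q : ℕ → RAMState → Prop}
    (h5 : σ.reg 5 = 1) (h1 : σ.reg 1 = s + 1) (h12 : σ.arr 12 (s + 1) = m)
    (h13 : σ.arr 13 (s + 1) = 1)
    (h : ∀ τ : RAMState, τ.arr = σ.arr → τ.reg 1 = s → τ.reg 2 = σ.reg 2 → τ.reg 3 = m →
      τ.reg 5 = 1 → τ.reg 9 = σ.reg 9 → combine.Terminates τ fun c => Q (c + 5)) :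
    mainBody.Terminates σ Q := by
  simp [mainBody, h1, h12, h13, h5]
  refine terminates_cond_of_ne (by simp) ?_
  refine (h _ (by simp) (by simp) (by simp) (by simp) (by simp [h5]) (by simp)).mono ?_
  intro c τ hQ
  convert hQ using 1
  omega

/-- Popping the stack or loading a node's kind changes only registers that a frame ignores, so a
frame from the later state is one from the earlier state. -/
theorem Frame.of_eq {N : Set ℕ} {b : ℕ} {σ σ' τ : RAMState} (h : Frame N b σ' τ)
    (harr : σ'.arr = σ.arr) (h2 : σ'.reg 2 = σ.reg 2) (h5 : σ'.reg 5 = σ.reg 5)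
    (h9 : σ'.reg 9 = σ.reg 9) : Frame N b σ τ := by
  obtain ⟨f1, f2, f3, f4, f5, f6, f7⟩ := h
  rw [harr] at f1 f3 f4 f5
  rw [h2] at f2 f3
  exact ⟨f1, f2, f3, f4, f5, f6.trans h5, f7.trans h9⟩

theorem Done.of_eq {t : GCotree V} {m : ℕ} {σ σ' : RAMState} (h : Done t I m σ)
    (harr : σ'.arr = σ.arr) (h2 : σ'.reg 2 = σ.reg 2) : Done t I m σ' := by
  obtain ⟨d1, d2, d3, d4⟩ := h
  rw [← harr] at d1 d2 d3 d4
  rw [← h2] at d2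
  exact ⟨d1, d2, d3, d4⟩

theorem combine_terminates {op : NodeOp} {l r : GCotree V} {σ : RAMState} {m : ℕ} (b : ℕ)
    (hw : (GCotree.node op l r).WellFormed)
    (hI : (GCotree.node op l r).graph.IsIndepSet (I : Set V))
    (h5 : σ.reg 5 = 1) (h9 : σ.reg 9 = 0) (hm : σ.reg 3 = m) (hk : σ.arr 0 m = op.code)
    (hl : Done l I (σ.arr 1 m) σ) (hr : Done r I (σ.arr 2 m) σ) :
    combine.Terminates σ fun c τ =>
      c ≤ 50 * ((GCotree.node op l r).tokens I + 1) + 40 ∧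
      τ.reg 1 = σ.reg 1 ∧ Frame {m} b σ τ ∧ Done (.node op l r) I m τ := by
  cases op with
  | union => exact combine_terminates_union b hw hI h5 h9 hm hk hl hr
  | join => exact combine_terminates_join b hw hI h5 h9 hm hk hl hr

theorem visit_terminates_leaf {S : Finset V} {H : SimpleGraph V} {vnum : V → ℕ} {σ : RAMState}
    {m : ℕ} (b : ℕ) (h5 : σ.reg 5 = 1) (hm : σ.reg 3 = m)
    (hs : (GCotree.leaf S H).StoredIn σ I vnum fun _ => m)
    (hI : ∀ v, σ.arr 4 (vnum v) = if v ∈ I then 1 else 0) :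
    visit.Terminates σ fun c τ => c ≤ 7 * (GCotree.leaf S H).tokens I + 30 ∧
      τ.reg 1 = σ.reg 1 ∧ Frame {m} b σ τ ∧ Done (.leaf S H) I m τ := by
  have back : ∀ {σ' : RAMState}, σ'.arr = σ.arr → σ'.reg 2 = σ.reg 2 → σ'.reg 1 = σ.reg 1 →
      σ'.reg 5 = σ.reg 5 → σ'.reg 9 = σ.reg 9 → ∀ {c : ℕ} {τ : RAMState},
      c ≤ 7 * (GCotree.leaf S H).tokens I + 20 ∧ τ.reg 1 = σ'.reg 1 ∧ Frame {m} b σ' τ ∧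
        Done (.leaf S H) I m τ → 1 + (1 + (c + 1 + 1 + 1)) ≤ 7 * (GCotree.leaf S H).tokens I + 30 ∧
        τ.reg 1 = σ.reg 1 ∧ Frame {m} b σ τ ∧ Done (.leaf S H) I m τ := by
    rintro σ' e e2 e1 e5 e9 c τ ⟨hc, h1, hf, hd⟩
    exact ⟨by omega, h1.trans e1, hf.of_eq e e2 e5 e9, hd⟩
  by_cases h1 : S.card = 1
  · obtain ⟨v, rfl⟩ := Finset.card_eq_one.1 h1
    obtain ⟨hk, hv⟩ := hs.1 v rfl
    simp [visit, hm, hk, h5]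
    refine terminates_cond_of_eq (by simp) (terminates_cond_of_eq (by simp) ?_)
    refine (trivialLeaf_terminates (H := H) b (by simpa using h5) (by simpa using hm) (by simpa using hv)
      (by simpa using hI v)).mono ?_
    rintro c τ ⟨hc, h⟩
    simpa only [terminates_block_nil] using back (by simp) (by simp) (by simp) (by simp) (by simp)
      ⟨by omega, h⟩
  · obtain ⟨hk, htok, hris⟩ := hs.2 h1
    simp [visit, hm, hk, h5]
    refine terminates_cond_of_eq (by simp) (terminates_cond_of_ne (by simp) ?_)
    refine (nontrivialLeaf_terminates b (by simpa using h5) (by simpa using hm)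
      (by simpa using htok) (by simpa using hris)).mono ?_
    intro c τ h
    simpa only [terminates_block_nil] using back (by simp) (by simp) (by simp) (by simp) (by simp) h

theorem visit_terminates_node {σ : RAMState} {op : NodeOp} {m : ℕ} (h5 : σ.reg 5 = 1)
    (h9 : σ.reg 9 = 0) (hm : σ.reg 3 = m) (hk : σ.arr 0 m = op.code) :
    visit.Terminates σ fun c τ => c ≤ 30 ∧ τ.reg 1 = σ.reg 1 + 3 ∧
      Frame ∅ (σ.reg 1) σ τ ∧ τ.arr 12 (σ.reg 1 + 1) = m ∧ τ.arr 13 (σ.reg 1 + 1) = 1 ∧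
      τ.arr 12 (σ.reg 1 + 2) = σ.arr 2 m ∧ τ.arr 13 (σ.reg 1 + 2) = 0 ∧
      τ.arr 12 (σ.reg 1 + 3) = σ.arr 1 m ∧ τ.arr 13 (σ.reg 1 + 3) = 0 := by
  -- Leaves have kinds `0` and `1`, so truncated `kind - 1` is nonzero exactly at inner nodes.
  have hop : op.code - 1 ≠ 0 := by cases op <;> decide
  simp only [visit, terminates_block_cons, terminates_load, terminates_sub]
  refine terminates_cond_of_ne (by simpa [hm, hk, h5] using hop) ?_
  refine (pushChildren_terminates (m := m) (by simpa using h5) (by simpa using h9)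
    (by simpa using hm)).mono ?_
  rintro c τ ⟨hc, h1, hf, h⟩
  simp at h1 h
  have hf' : Frame ∅ (σ.reg 1) σ τ := hf.of_eq rfl (by simp) (by simp) (by simp)
  simp only [terminates_block_nil]
  exact ⟨by omega, h1, hf', h⟩

omit [DecidableEq V] in
theorem sub_root (t : GCotree V) : t.sub t.root = t := by cases t <;> rfl

/-- The main loop processes the subtree of a node on top of the stack. -/
theorem reaches_subtree {vnum : V → ℕ} (t : GCotree V) (num : t.Node → ℕ)
    (hnum : Function.Injective num) (hw : t.WellFormed) (hI : t.graph.IsIndepSet (I : Set V))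
    {σ : RAMState} {s : ℕ} (hs : t.StoredIn σ I vnum num)
    (hmem : ∀ v, σ.arr 4 (vnum v) = if v ∈ I then 1 else 0)
    (h5 : σ.reg 5 = 1) (h9 : σ.reg 9 = 0) (h1 : σ.reg 1 = s + 1)
    (h12 : σ.arr 12 (s + 1) = num t.root) (h13 : σ.arr 13 (s + 1) = 0) :
    ∃ n τ, Reaches σ n τ ∧ n ≤ 200 * t.size I ∧ τ.reg 1 = s ∧ Frame (Set.range num) s σ τ ∧
      ∀ u, Done (t.sub u) I (num u) τ := by
  induction t generalizing σ s with
  | leaf S H =>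
    obtain ⟨n, τ, hreach, hn, hτ1, hf, hd⟩ := reaches_of_terminates (by omega)
      (mainBody_terminates_visit (Q := fun c τ => c ≤ 7 * (GCotree.leaf S H).tokens I + 35 ∧
        τ.reg 1 = s ∧ Frame (Set.range num) s σ τ ∧ Done (.leaf S H) I (num ()) τ)
        h5 h1 h12 h13 fun τ harr t1 t2 t3 t5 t9 => by
          refine (visit_terminates_leaf (I := I) (S := S) (H := H) (vnum := vnum) s t5 t3
            (storedIn_congr (fun a _ i => by rw [harr]) hs) (by rwa [harr])).mono ?_
          rintro c ρ ⟨hc, hρ1, hf, hd⟩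
          exact ⟨by omega, hρ1.trans t1, (hf.of_eq harr t2 (t5.trans h5.symm) t9).mono
            (Set.singleton_subset_iff.2 ⟨_, rfl⟩) le_rfl, hd⟩)
    refine ⟨_, τ, hreach, ?_, hτ1, hf, fun u => hd⟩
    rw [GCotree.size]
    have h1 := le_max_left 1 ((GCotree.leaf S H).tokens I)
    have h2 := le_max_right 1 ((GCotree.leaf S H).tokens I)
    omega
  | node op l r ihl ihr =>
    obtain ⟨hk, hleft, hright, hsl, hsr⟩ := hs
    have hinl : Function.Injective fun u : l.Node => num (some (.inl u)) := fun u v e =>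
      Sum.inl.inj (Option.some.inj (hnum e))
    have hinr : Function.Injective fun u : r.Node => num (some (.inr u)) := fun u v e =>
      Sum.inr.inj (Option.some.inj (hnum e))
    have hl_not : ∀ u : l.Node,
        num (some (.inl u)) ∉ Set.range fun u : r.Node => num (some (.inr u)) := by
      rintro u ⟨v, hv⟩
      cases hnum hv
    have hsome : ∀ u, num (some u) ∉ ({num none} : Set ℕ) := fun u hu => by
      cases hnum hu
    -- push the children
    obtain ⟨n₁, σ₁, hreach₁, hn₁, t1, hf₁, h12m, h13m, h12r, h13r, h12l, h13l⟩ :=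
      reaches_of_terminates (by omega)
      (mainBody_terminates_visit (Q := fun c τ => c ≤ 35 ∧ τ.reg 1 = s + 3 ∧
        Frame ∅ s σ τ ∧ τ.arr 12 (s + 1) = num none ∧ τ.arr 13 (s + 1) = 1 ∧
        τ.arr 12 (s + 2) = num (some (.inr r.root)) ∧ τ.arr 13 (s + 2) = 0 ∧
        τ.arr 12 (s + 3) = num (some (.inl l.root)) ∧ τ.arr 13 (s + 3) = 0)
        h5 h1 h12 h13 fun τ harr t1 t2 t3 t5 t9 => by
          refine (visit_terminates_node (op := op) t5 (t9.trans h9) t3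
            (by rw [harr]; exact hk)).mono ?_
          rw [t1, harr]
          rintro c ρ ⟨hc, hρ1, hf, h⟩
          refine ⟨by omega, hρ1, hf.of_eq harr t2 (t5.trans h5.symm) t9, ?_⟩
          rwa [← hleft, ← hright])
    -- the left subtree
    obtain ⟨n₂, σ₂, hreach₂, hn₂, t1', hf₂, hd₂⟩ := ihl _ hinl hw.1
      (GCotree.isIndepSet_of_le (GCotree.graph_le_node_left op l r) hI)
      (storedIn_congr hf₁.input hsl) (fun v => (hf₁.input 4 (by omega) _).trans (hmem v))
      (hf₁.one.trans h5) (hf₁.zero.trans h9) (s := s + 2) t1 h12l h13l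
    -- the right subtree
    obtain ⟨n₃, σ₃, hreach₃, hn₃, t1'', hf₃, hd₃⟩ := ihr _ hinr hw.2.1
      (GCotree.isIndepSet_of_le (GCotree.graph_le_node_right op l r) hI)
      (storedIn_congr hf₂.input (storedIn_congr hf₁.input hsr))
      (fun v => (hf₂.input 4 (by omega) _).trans ((hf₁.input 4 (by omega) _).trans (hmem v)))
      (hf₂.one.trans (hf₁.one.trans h5)) (hf₂.zero.trans (hf₁.zero.trans h9))
      (s := s + 1) t1' ((hf₂.stack _ le_rfl).1.trans h12r) ((hf₂.stack _ le_rfl).2.trans h13r)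
    have hf₁₃ : Frame (Set.range num) s σ σ₃ :=
      ((hf₁.mono (Set.empty_subset _) le_rfl).trans
        (hf₂.mono (by rintro _ ⟨u, rfl⟩; exact ⟨_, rfl⟩) (by omega))).trans
        (hf₃.mono (by rintro _ ⟨u, rfl⟩; exact ⟨_, rfl⟩) (by omega))
    -- The right subtree writes its tables above those of the left one, and its node numbers differ
    -- by injectivity of `num`.
    have hdl : ∀ u, Done (l.sub u) I (num (some (.inl u))) σ₃ := fun u =>
      (hd₂ u).frame hf₃ (hl_not u)
    -- combine
    obtain ⟨n₄, σ₄, hreach₄, hn₄, t1₄, hf₄, hd₄⟩ := reaches_of_terminates (by omega)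
      (mainBody_terminates_combine (Q := fun c τ =>
        c ≤ 50 * ((GCotree.node op l r).tokens I + 1) + 45 ∧ τ.reg 1 = s ∧
        Frame {num none} s σ₃ τ ∧ Done (.node op l r) I (num none) τ)
        (hf₁₃.one.trans h5) t1''
        ((hf₃.stack _ le_rfl).1.trans ((hf₂.stack _ (by omega)).1.trans h12m))
        ((hf₃.stack _ le_rfl).2.trans ((hf₂.stack _ (by omega)).2.trans h13m))
        fun τ harr t1 t2 t3 t5 t9 => by
          have eL : τ.arr 1 (num none) = num (some (.inl l.root)) := by
            rw [harr, hf₁₃.input 1 (by omega)]; exact hleft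
          have eR : τ.arr 2 (num none) = num (some (.inr r.root)) := by
            rw [harr, hf₁₃.input 2 (by omega)]; exact hright
          have dL := (hdl l.root).of_eq harr t2
          have dR := (hd₃ r.root).of_eq harr t2
          rw [sub_root] at dL dR
          refine (combine_terminates (op := op) (I := I) s hw hI t5
            (t9.trans (hf₁₃.zero.trans h9)) t3
            (by rw [harr, hf₁₃.input 0 (by omega)]; exact hk)
            (by rwa [eL]) (by rwa [eR])).mono ?_
          rintro c ρ ⟨hc, hρ1, hf, hd⟩
          exact ⟨by omega, hρ1.trans t1,
            hf.of_eq harr t2 (t5.trans (hf₁₃.one.trans h5).symm) t9, hd⟩)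
    refine ⟨_, σ₄, ((hreach₁.trans hreach₂).trans hreach₃).trans hreach₄, ?_, t1₄,
      hf₁₃.trans (hf₄.mono (Set.singleton_subset_iff.2 ⟨_, rfl⟩) le_rfl), ?_⟩
    -- The node's own two rounds cost at most `36` and `50 * (t + 1) + 46` for `t` tokens, which is
    -- below `200 * max 1 t`.
    · rw [GCotree.size]
      have h1 := le_max_left 1 ((GCotree.node op l r).tokens I)
      have h2 := le_max_right 1 ((GCotree.node op l r).tokens I)
      omega
    · rintro (_ | u | u)
      · exact hd₄
      · exact (hdl u).frame hf₄ (hsome _)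
      · exact (hd₃ u).frame hf₄ (hsome _)

theorem prog_terminates [Fintype V] {T : GCotree V} (hw : T.WellFormed)
    (hI : T.graph.IsIndepSet (I : Set V)) {num : T.Node ≃ Fin (Fintype.card T.Node)}
    {vnum : V ≃ Fin (Fintype.card V)} {σ : RAMState} (h : IsInput T I num vnum σ) :
    prog.Terminates σ fun c τ => IsOutput T I num τ ∧ c ≤ 300 * T.size I := by
  obtain ⟨h0, hmem, hs⟩ := h
  simp [prog, h0]
  set σ₀ := (((((σ.setReg 1 1).setReg 2 0).setReg 5 1).setReg 9 0).setArr 12 1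
    (num T.root)).setArr 13 1 0 with hσ₀
  have hin : ∀ a < 8, ∀ i, σ₀.arr a i = σ.arr a i := fun a ha i => by
    simp [hσ₀, show a ≠ 12 by omega, show a ≠ 13 by omega]
  obtain ⟨n, τ, hreach, hn, h1, -, hd⟩ := reaches_subtree (vnum := fun v => (vnum v : ℕ)) T
    (fun u => (num u : ℕ)) (fun u v e => num.injective (Fin.ext e)) hw hI
    (storedIn_congr hin hs) (fun v => (hin 4 (by omega) _).trans (hmem v)) (σ := σ₀)
    (by simp [hσ₀]) (by simp [hσ₀]) (s := 0) (by simp [hσ₀]) (by simp [hσ₀]) (by simp [hσ₀])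
  refine ⟨_, τ, hreach _ _ (.loopDone h1), ⟨fun u => (hd u).ris, ?_⟩, ?_⟩
  · intro u l r hu ℓ hℓ x y
    exact ((hd u).stable l r hu ℓ hℓ).isMaxStable_iff x y
  -- The constant cost of initialisation and of the last test is absorbed by raising `200` to `300`.
  · have : 1 ≤ T.size I := by
      cases T with
      | leaf S H => exact le_max_left _ _
      | node op l r => exact (le_max_left _ _).trans ((Nat.le_add_right _ _).trans
          (Nat.le_add_right _ _))
    omega

end CotreeProg

/-! ### The theorem. -/

theorem mainTheorem10 :
    ∃ (P : RAMProg) (C : ℕ),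
      ∀ (V : Type*) [Fintype V] [DecidableEq V] (G : SimpleGraph V) (T : GCotree V) (I : Finset V),
        T.IsCotreeOf G → G.IsIndepSet (I : Set V) →
        (∀ (num : T.Node ≃ Fin (Fintype.card T.Node)) (vnum : V ≃ Fin (Fintype.card V))
            (σ : RAMState), IsInput T I num vnum σ →
          ∃ (c : ℕ) (σ' : RAMState), P.Exec σ c σ' ∧ IsOutput T I num σ' ∧
            c ≤ C * ∑ u : T.Node, max 1 ((T.sub u).tokens I)) ∧
        ∑ u : T.Node, max 1 ((T.sub u).tokens I) ≤ Fintype.card V ^ 2 := by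
  refine ⟨CotreeProg.prog, 300, ?_⟩
  rintro V _ _ G T I ⟨hw, hv, rfl⟩ hI
  rw [GCotree.sum_tokens_eq_size]
  refine ⟨fun num vnum σ h => CotreeProg.prog_terminates hw hI h, ?_⟩
  have := hw.size_le I
  rwa [hv, Finset.card_univ] at this
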